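/- Let $\sigma>0$, $\rho\in[0,1)$, $P>0$, $N_1>0$. For blocklength $n$, let $(S_{1,k},S_{2,k})$, $k=1,\dots,n$, be IID zero-mean bivariate Gaussian pairs with covariance matrix $\sigma^2\begin{pmatrix}1&\rho\\ \rho&1\end{pmatrix}$, and, independent of them, let $Z_1,\dots,Z_n$ be IID $\mathcal N(0,N_1)$. A sequence of schemes consists, for every $n$, of a (measurable) encoder $f^{(n)}:\mathbb R^n\times\mathbb R^n\to\mathbb R^n$ and (measurable) reconstructors $\phi_1^{(n)},\phi_2^{(n)}:\mathbb R^n\to\mathbb R^n$, where $\mathbf X=f^{(n)}(\mathbf S_1,\mathbf S_2)$ satisfies $\frac1n\sum_{k=1}^n \mathsf E[X_k^2]\le P$; the receiver observes $\mathbf Y=\mathbf X+\mathbf Z$ and forms $\hat{\mathbf S}_i=\phi_i^{(n)}(\mathbf Y)$, $i=1,2$. The sequence achieves $(D_1,D_2)$ if $\varlimsup_{n\to\infty}\frac1n\sum_{k=1}^n\mathsf E[(S_{i,k}-\hat S_{i,k})^2]\le D_i$ for $i=1,2$. Let $\tilde D_2^*(D_1)$ be the infimum of all $\tilde D_2$ such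 that some sequence of schemes achieves $(D_1,\tilde D_2)$. For $\alpha,\beta\ge 0$, not both zero, the uncoded scheme uses $$X_k=\sqrt{\frac{P}{\sigma^2(\alpha^2+2\alpha\beta\rho+\beta^2)}}\,(\alpha S_{1,k}+\beta S_{2,k}),\qquad \hat S_{i,k}=\mathsf E[S_{i,k}\mid Y_k],\quad i=1,2,$$ and we put $$D_1^{\mathrm u}(\alpha,\beta)=\sigma^2\,\frac{P^2\beta^2(1-\rho^2)+PN_1(\alpha^2+2\alpha\beta\rho+\beta^2(2-\rho^2))+N_1^2(\alpha^2+2\alpha\beta\rho+\beta^2)}{(P+N_1)^2(\alpha^2+2\alpha\beta\rho+\beta^2)}.$$ Suppose that $$\sigma^2\frac{N_1}{N_1+P}\le D_1<\sigma^2\,\frac{N_1+P(1-\rho^2)}{N_1+P}\qquad\text{and}\qquad \frac P{N_1}\le\Gamma(D_1,\sigma^2,\rho),$$ where $$\Gamma(D_1,\sigma^2,\rho)=\frac{\sigma^4(1-\rho^2)-2D_1\sigma^2(1-\rho^2)+D_1^2}{D_1(\sigma^2(1-\rho^2)-D_1)}\quad\text{if }0<D_1<\sigma^2(1-\rho^2),$$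 and $\Gamma(D_1,\sigma^2,\rho)=+\infty$ otherwise. Then there exist $\alpha,\beta\ge0$, not both zero, with $D_1^{\mathrm u}(\alpha,\beta)=D_1$, and for all such $\alpha,\beta$ $$\tilde D_2^*(D_1)=\sigma^2\,\frac{P^2\alpha^2(1-\rho^2)+PN_1(\alpha^2(2-\rho^2)+2\alpha\beta\rho+\beta^2)+N_1^2(\alpha^2+2\alpha\beta\rho+\beta^2)}{(P+N_1)^2(\alpha^2+2\alpha\beta\rho+\beta^2)}.$$ Moreover, the pair $(D_1,\tilde D_2^*(D_1))$ is achieved by the uncoded scheme with these $\alpha,\beta$. -/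

import Mathlib

open MeasureTheory ProbabilityTheory Filter
open scoped ENNReal

noncomputable section

namespace GaussianLink

/-- The law of one source pair `(S₁, S₂)`: zero-mean bivariate Gaussian with covariance matrix
`v * (1 ρ; ρ 1)`, where `v` is the common variance. Coordinate `0` is `S₁`, coordinate `1` is
`S₂`. -/
def sourceLaw (v ρ : ℝ) : Measure (EuclideanSpace ℝ (Fin 2)) :=
  multivariateGaussian 0 (v • !![1, ρ; ρ, 1])

instance (v ρ : ℝ) : IsProbabilityMeasure (sourceLaw v ρ) := by
  unfold sourceLaw
  infer_instance

/-- Outcomes for blocklength `n`: the `n` source pairs and the `n` noise samples. -/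
abbrev Outcome (n : ℕ) : Type :=
  (Fin n → EuclideanSpace ℝ (Fin 2)) × (Fin n → ℝ)

/-- The joint law for blocklength `n`: IID source pairs, and, independent of them, IID centred
Gaussian noise samples of variance `N`. -/
def linkLaw (v ρ N : ℝ) (n : ℕ) : Measure (Outcome n) :=
  (Measure.pi fun _ => sourceLaw v ρ).prod (Measure.pi fun _ => gaussianReal 0 N.toNNReal)

instance (v ρ N : ℝ) (n : ℕ) : IsProbabilityMeasure (linkLaw v ρ N n) := by
  unfold linkLaw
  infer_instance

/-- The `i`-th source sequence (`i = 0` for `S₁`, `i = 1` for `S₂`). -/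
def source {n : ℕ} (i : Fin 2) (ω : Outcome n) : Fin n → ℝ := fun k => ω.1 k i

/-- An encoder of blocklength `n`. -/
abbrev Encoder (n : ℕ) : Type := (Fin n → ℝ) → (Fin n → ℝ) → (Fin n → ℝ)

/-- A reconstruction function of blocklength `n`. -/
abbrev Reconstructor (n : ℕ) : Type := (Fin n → ℝ) → (Fin n → ℝ)

/-- The channel input `X = f (S₁, S₂)`. -/
def input {n : ℕ} (f : Encoder n) (ω : Outcome n) : Fin n → ℝ :=
  f (source 0 ω) (source 1 ω)

/-- The channel output `Y = X + Z`. -/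
def output {n : ℕ} (f : Encoder n) (ω : Outcome n) : Fin n → ℝ :=
  fun k => input f ω k + ω.2 k

/-- The expected average power `(1/n) ∑ₖ E[Xₖ²]`, as an extended nonnegative number. -/
def averagePower (v ρ N : ℝ) {n : ℕ} (f : Encoder n) : ℝ≥0∞ :=
  (∑ k, ∫⁻ ω, ENNReal.ofReal (input f ω k ^ 2) ∂(linkLaw v ρ N n)) / (n : ℝ≥0∞)

/-- The expected average squared error `(1/n) ∑ₖ E[(Sᵢₖ - φ(Y)ₖ)²]`, as an extended nonnegative
number. -/
def averageDistortion (v ρ N : ℝ) {n : ℕ} (f : Encoder n) (φ : Reconstructor n) (i : Fin 2) :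
    ℝ≥0∞ :=
  (∑ k, ∫⁻ ω, ENNReal.ofReal ((source i ω k - φ (output f ω) k) ^ 2) ∂(linkLaw v ρ N n)) /
    (n : ℝ≥0∞)

/-- A sequence of coding schemes for the single link: for every blocklength an encoder and two
reconstruction functions, `est 0` for `S₁` and `est 1` for `S₂`, both applied to the output of the
same link. -/
structure Scheme where
  enc : (n : ℕ) → Encoder n
  est : Fin 2 → (n : ℕ) → Reconstructor n

/-- The sequence of schemes `c` achieves the distortion pair `(D₁, D₂)` over the link with noise
variance `N` under the average power constraint `P`. The conditions `0 ≤ D₁`, `0 ≤ D₂` hold for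
every upper bound of a limit superior of squared errors; they are listed only because
`ENNReal.ofReal` truncates at zero. -/
structure Scheme.Achieves (c : Scheme) (v ρ P N D₁ D₂ : ℝ) : Prop where
  measurable_enc : ∀ n, Measurable fun s : (Fin n → ℝ) × (Fin n → ℝ) => c.enc n s.1 s.2
  measurable_est : ∀ i n, Measurable (c.est i n)
  power : ∀ n, averagePower v ρ N (c.enc n) ≤ ENNReal.ofReal P
  nonneg₁ : 0 ≤ D₁
  nonneg₂ : 0 ≤ D₂
  distortion₁ :
    limsup (fun n => averageDistortion v ρ N (c.enc n) (c.est 0 n) 0) atTop ≤ ENNReal.ofReal D₁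
  distortion₂ :
    limsup (fun n => averageDistortion v ρ N (c.enc n) (c.est 1 n) 1) atTop ≤ ENNReal.ofReal D₂

/-- The least distortion on `S₂` at the receiver of the link, subject to distortion `D₁` on `S₁`
at the same receiver. -/
def leastDistortion₂ (v ρ P N D₁ : ℝ) : ℝ :=
  sInf {D₂ : ℝ | ∃ c : Scheme, c.Achieves v ρ P N D₁ D₂}

/-- The uncoded encoder: `Xₖ = √(P / (v (α² + 2αβρ + β²))) (α S₁ₖ + β S₂ₖ)`. -/
def uncodedEncoder (v ρ P α β : ℝ) (n : ℕ) : Encoder n := fun s₁ s₂ k =>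
  Real.sqrt (P / (v * (α ^ 2 + 2 * α * β * ρ + β ^ 2))) * (α * s₁ k + β * s₂ k)

/-- The uncoded scheme: the uncoded encoder, and for each source component and each time `k` the
minimum mean squared-error estimate `E[Sᵢₖ | Yₖ]`, evaluated through the regular conditional
distribution of `Sᵢₖ` given the scalar output `Yₖ`. -/
def uncodedScheme (v ρ P N α β : ℝ) : Scheme where
  enc := uncodedEncoder v ρ P α β
  est i n := fun y k =>
    ∫ s, s ∂(condDistrib (fun ω => source i ω k)
      (fun ω => output (uncodedEncoder v ρ P α β n) ω k) (linkLaw v ρ N n) (y k))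

/-- The distortion on `S₁` of the uncoded scheme over the link with noise variance `N`. -/
def uncodedDistortion₁ (v ρ P N α β : ℝ) : ℝ :=
  v * ((P ^ 2 * β ^ 2 * (1 - ρ ^ 2) +
      P * N * (α ^ 2 + 2 * α * β * ρ + β ^ 2 * (2 - ρ ^ 2)) +
      N ^ 2 * (α ^ 2 + 2 * α * β * ρ + β ^ 2)) /
    ((P + N) ^ 2 * (α ^ 2 + 2 * α * β * ρ + β ^ 2)))

/-- The threshold `Γ(D₁, v, ρ)` on the signal-to-noise ratio, infinite unless
`0 < D₁ < v (1 - ρ²)`. -/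
def snrThreshold (D₁ v ρ : ℝ) : EReal :=
  open Classical in
  if 0 < D₁ ∧ D₁ < v * (1 - ρ ^ 2) then
    (((v ^ 2 * (1 - ρ ^ 2) - 2 * D₁ * v * (1 - ρ ^ 2) + D₁ ^ 2) /
      (D₁ * (v * (1 - ρ ^ 2) - D₁)) : ℝ) : EReal)
  else ⊤

end GaussianLink

end

/-!
The uncoded scheme achieves its distortion pair by a second-moment computation, so the content is
the converse: no sequence of schemes does better on `S₂`.

Fix `α, β` and write `Sᵢ = pᵢ T + qᵢ U` with `T, U` independent standard Gaussians, `T` being the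
normalised channel input of the uncoded scheme (`sourceLaw_eq_map`, `signalCoeff`,
`residualCoeff`). After the uncoded scheme, `T` given the channel output has variance
`N / (P + N)`, while `U` is independent of the output. Its optimality is certified by weights
`lam₀, lam₁ > 0` and `m ≥ 0` for which
`lam₀ S₁² + lam₁ S₂² + m U² = (P + N) / N * T² + U²`
as quadratic forms, the inverse of that conditional covariance (`BackwardWeights`). For
`α, β > 0` they exist when `(1 - ρ²) P α β ≤ N ρ (α² + 2αβρ + β²)` (`backwardWeights_of_pos`), and this
follows from the threshold on `P / N` by a factorisation of the threshold polynomial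
(`snr_bound_of_le_snrThreshold`).

Given the weights, let an arbitrary scheme of blocklength `n` have input `X`, output `Y = X + Z` and
estimates `Ŝᵢ`. Compare the true law of `(T, U, Y)` with the measure whose output is white of
variance `P + N` and whose backward density, given the output, is
`exp (-(lam₀ (S₁ - Ŝ₁)² + lam₁ (S₂ - Ŝ₂)² + m U²) / 2)` times the normalising constant of the
Gaussian with variances `N / (P + N)` and `1`. Completing the square shows that this measure
has total mass at most one (`BackwardWeights.lintegral_exp_le_one`), so the log-likelihood ratio
`G` satisfies `E (exp G) ≤ 1`, hence `E G ≤ 0` because `1 + G ≤ exp G`. This is the nonnegativity of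
relative entropy, and it replaces mutual information, rate-distortion functions and the data
processing inequality. Since `G` is quadratic, `E G ≤ 0` is the linear bound
`lam₀ D₁ + lam₁ D₂ ≥ 2 - m` on the distortions, with equality for the uncoded scheme.

At `β = 0` with `ρ > 0` the weight `lam₁` degenerates to zero, and the bound on `D₂` is obtained from
those at `β > 0` by letting `β` tend to zero (`uncodedDistortion_le_of_achieves`).
-/

namespace GaussianLink

/-! ### Product measures and Gaussian tilting -/

theorem lintegral_pi_prod {ι : Type*} [Fintype ι] {E : ι → Type*}
    [∀ i, MeasurableSpace (E i)] (μ : ∀ i, Measure (E i)) [∀ i, IsProbabilityMeasure (μ i)]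
    {f : ∀ i, E i → ℝ≥0∞} (hf : ∀ i, Measurable (f i)) :
    ∫⁻ x, ∏ i, f i (x i) ∂Measure.pi μ = ∏ i, ∫⁻ y, f i y ∂μ i := by
  rw [lintegral_prod_eq_prod_lintegral_of_indepFun Finset.univ (fun i (x : ∀ i, E i) => f i (x i))
    (iIndepFun_pi fun i => (hf i).aemeasurable)
    (fun i => (hf i).comp (measurable_pi_apply i))]
  exact Finset.prod_congr rfl fun i _ => (measurePreserving_eval μ i).lintegral_comp (hf i)

theorem pi_withDensity_prod {ι : Type*} [Fintype ι] {E : ι → Type*}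
    [∀ i, MeasurableSpace (E i)] (μ : ∀ i, Measure (E i)) [∀ i, IsProbabilityMeasure (μ i)]
    {f : ∀ i, E i → ℝ≥0∞} (hf : ∀ i, Measurable (f i))
    [∀ i, SigmaFinite ((μ i).withDensity (f i))] :
    (Measure.pi μ).withDensity (fun x => ∏ i, f i (x i)) =
      Measure.pi fun i => (μ i).withDensity (f i) := by
  refine (Measure.pi_eq fun s hs => ?_).symm
  rw [withDensity_apply _ (MeasurableSet.univ_pi hs), ← lintegral_indicator (.univ_pi hs)]
  have h : (Set.univ.pi s).indicator (fun x : ∀ i, E i => ∏ i, f i (x i)) =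
      fun x => ∏ i, (s i).indicator (f i) (x i) := by
    ext x
    by_cases hx : x ∈ Set.univ.pi s
    · rw [Set.indicator_of_mem hx]
      exact Finset.prod_congr rfl fun i _ => (Set.indicator_of_mem (hx i trivial) _).symm
    · rw [Set.indicator_of_notMem hx]
      obtain ⟨i, hi⟩ : ∃ i, x i ∉ s i := by simpa using hx
      exact (Finset.prod_eq_zero (Finset.mem_univ i) (Set.indicator_of_notMem hi _)).symm
  rw [h, lintegral_pi_prod μ fun i => (hf i).indicator (hs i)]
  refine Finset.prod_congr rfl fun i _ => ?_
  rw [withDensity_apply _ (hs i), lintegral_indicator (hs i)]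

/-- The likelihood ratio of two Gaussian laws with arbitrary means and variances. -/
theorem gaussianReal_withDensity_exp {x y v w : ℝ} (hv : 0 < v) (hw : 0 < w) :
    (gaussianReal x v.toNNReal).withDensity (fun t => ENNReal.ofReal
      (Real.sqrt (v / w) * Real.exp ((t - x) ^ 2 / (2 * v) - (t - y) ^ 2 / (2 * w)))) =
      gaussianReal y w.toNNReal := by
  have hv' : v.toNNReal ≠ 0 := by simpa using hv
  have hw' : w.toNNReal ≠ 0 := by simpa using hw
  rw [gaussianReal_of_var_ne_zero _ hv', gaussianReal_of_var_ne_zero _ hw',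
    ← withDensity_mul _ (measurable_gaussianPDF _ _) (by fun_prop)]
  congr 1
  ext t
  rw [Pi.mul_apply, gaussianPDF_def, gaussianPDF_def,
    ← ENNReal.ofReal_mul (gaussianPDFReal_nonneg _ _ _), gaussianPDFReal_def, gaussianPDFReal_def]
  dsimp only
  rw [Real.coe_toNNReal _ hv.le, Real.coe_toNNReal _ hw.le]
  congr 1
  have h1 : Real.exp (-(t - x) ^ 2 / (2 * v)) *
      Real.exp ((t - x) ^ 2 / (2 * v) - (t - y) ^ 2 / (2 * w)) =
      Real.exp (-(t - y) ^ 2 / (2 * w)) := by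
    rw [← Real.exp_add]; congr 1; ring
  have h2 : (Real.sqrt (2 * Real.pi * v))⁻¹ * Real.sqrt (v / w) =
      (Real.sqrt (2 * Real.pi * w))⁻¹ := by
    rw [← Real.sqrt_inv, ← Real.sqrt_mul (by positivity), ← Real.sqrt_inv]
    congr 1
    field_simp
  rw [← h1, ← h2]
  ring

theorem lintegral_exp_gaussianReal {x y v w : ℝ} (hv : 0 < v) (hw : 0 < w) :
    ∫⁻ t, ENNReal.ofReal (Real.exp ((t - x) ^ 2 / (2 * v) - (t - y) ^ 2 / (2 * w)))
      ∂gaussianReal x v.toNNReal = ENNReal.ofReal (Real.sqrt (w / v)) := by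
  have h := congrArg (fun μ : Measure ℝ => μ Set.univ)
    (gaussianReal_withDensity_exp (x := x) (y := y) hv hw)
  simp only [withDensity_apply _ MeasurableSet.univ, Measure.restrict_univ, measure_univ] at h
  simp_rw [ENNReal.ofReal_mul (Real.sqrt_nonneg _)] at h
  rw [lintegral_const_mul _ (by fun_prop)] at h
  have h3 : ENNReal.ofReal (Real.sqrt (w / v)) * ENNReal.ofReal (Real.sqrt (v / w)) = 1 := by
    rw [← ENNReal.ofReal_mul (Real.sqrt_nonneg _), ← Real.sqrt_mul (by positivity)]
    have : w / v * (v / w) = 1 := by field_simp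
    simp [this]
  calc _ = ENNReal.ofReal (Real.sqrt (w / v)) * ENNReal.ofReal (Real.sqrt (v / w)) * _ := by
        rw [h3, one_mul]
    _ = _ := by rw [mul_assoc, h, mul_one]

/-- One source pair as a linear image of two independent standard Gaussians. The rows `(pᵢ, qᵢ)` are
any factor of the covariance matrix, so the coordinates can be chosen to suit an encoder. -/
theorem sourceLaw_eq_map {v ρ : ℝ} {p q : Fin 2 → ℝ} (hv : ∀ i, p i ^ 2 + q i ^ 2 = v)
    (hρ : p 0 * p 1 + q 0 * q 1 = v * ρ) :
    sourceLaw v ρ = ((gaussianReal 0 1).prod (gaussianReal 0 1)).map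
      (fun w => WithLp.toLp 2 fun i => p i * w.1 + q i * w.2) := by
  have hS : (v • !![1, ρ; ρ, 1] : Matrix (Fin 2) (Fin 2) ℝ) =
      !![p 0, q 0; p 1, q 1] * (!![p 0, q 0; p 1, q 1]).conjTranspose := by
    ext i j
    fin_cases i <;> fin_cases j <;>
      simp [Matrix.mul_apply, Fin.sum_univ_two] <;>
      linarith [hv 0, hv 1]
  have hpos : (v • !![1, ρ; ρ, 1] : Matrix (Fin 2) (Fin 2) ℝ).PosSemidef := by
    rw [hS]; exact Matrix.posSemidef_self_mul_conjTranspose _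
  have hm : Measurable fun w : ℝ × ℝ =>
      (WithLp.toLp 2 fun i => p i * w.1 + q i * w.2 : EuclideanSpace ℝ (Fin 2)) := by fun_prop
  apply Measure.ext_of_charFun
  ext x
  rw [sourceLaw, charFun_multivariateGaussian hpos, charFun_apply, integral_map hm.aemeasurable
    (Measurable.aestronglyMeasurable (by fun_prop))]
  have h (w : ℝ × ℝ) : Complex.exp ((inner ℝ
      (WithLp.toLp 2 fun i => p i * w.1 + q i * w.2 : EuclideanSpace ℝ (Fin 2)) x : ℝ) *
        Complex.I) =
      Complex.exp ((inner ℝ w.1 (x 0 * p 0 + x 1 * p 1) : ℝ) * Complex.I) *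
      Complex.exp ((inner ℝ w.2 (x 0 * q 0 + x 1 * q 1) : ℝ) * Complex.I) := by
    rw [← Complex.exp_add, ← add_mul, ← Complex.ofReal_add]
    congr 3
    simp [PiLp.inner_apply, Fin.sum_univ_two]
    ring
  simp_rw [h]
  rw [integral_prod_mul (fun t : ℝ =>
      Complex.exp ((inner ℝ t (x 0 * p 0 + x 1 * p 1) : ℝ) * Complex.I))
    (fun t : ℝ => Complex.exp ((inner ℝ t (x 0 * q 0 + x 1 * q 1) : ℝ) * Complex.I)),
    ← charFun_apply, ← charFun_apply, charFun_gaussianReal, charFun_gaussianReal,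
    ← Complex.exp_add]
  congr 1
  have h0 : (v : ℂ) = p 0 ^ 2 + q 0 ^ 2 := by rw [← hv 0]; push_cast; ring
  have h1 : (v : ℂ) = p 1 ^ 2 + q 1 ^ 2 := by rw [← hv 1]; push_cast; ring
  have h2 : (v : ℂ) * ρ = p 0 * p 1 + q 0 * q 1 := by
    rw [← Complex.ofReal_mul, ← hρ]; push_cast; ring
  simp [Matrix.mulVec, dotProduct, Fin.sum_univ_two]
  linear_combination (-(x 0 : ℂ) ^ 2 / 2) * h0 - (x 1 : ℂ) ^ 2 / 2 * h1 - (x 0 : ℂ) * x 1 * h2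

/-! ### The change-of-measure inequality -/

/-- The joint law for blocklength `n` in white coordinates: for each time an independent pair
`(T, U)` of standard Gaussians, and, independent of them, Gaussian noise of variance `N`. -/
noncomputable def whiteLaw (N : ℝ) (n : ℕ) : Measure ((Fin n → ℝ × ℝ) × (Fin n → ℝ)) :=
  (Measure.pi fun _ => (gaussianReal 0 1).prod (gaussianReal 0 1)).prod
    (Measure.pi fun _ => gaussianReal 0 N.toNNReal)

instance (N : ℝ) (n : ℕ) : IsProbabilityMeasure (whiteLaw N n) := by
  unfold whiteLaw
  infer_instance

/-- Weights `lam i` on the squared errors of the two source components `pᵢ T + qᵢ U`, and `m` on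
`U²`, for which the quadratic form `∑ i, lam i * (p i * T + q i * U) ^ 2 + m * U ^ 2` is
`a * T ^ 2 + U ^ 2`. The right side is the inverse covariance of `(T, U)` given the output of a channel
that carries `T` alone and leaves it with conditional variance `1 / a`. The weights are the
multipliers of the two distortion constraints, and `m` that of the constraint that estimating `U`
cannot be worse than guessing zero. -/
structure BackwardWeights (p q lam : Fin 2 → ℝ) (m a : ℝ) : Prop where
  lam_pos : ∀ i, 0 < lam i
  m_nonneg : 0 ≤ m
  fst_fst : ∑ i, lam i * p i ^ 2 = a
  fst_snd : ∑ i, lam i * (p i * q i) = 0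
  snd_snd : ∑ i, lam i * q i ^ 2 + m = 1

/-- The backward density given the output, whose estimates enter through `c`, has mass at most the
Gaussian normalising constant: the minimum over `(T, U)` of the quadratic form is nonnegative. -/
theorem BackwardWeights.lintegral_le {p q lam : Fin 2 → ℝ} {m a : ℝ}
    (h : BackwardWeights p q lam m a) (ha : 0 < a) (c : Fin 2 → ℝ) :
    ∫⁻ w : ℝ × ℝ, ENNReal.ofReal (Real.exp ((w.1 ^ 2 + w.2 ^ 2 - m * w.2 ^ 2 -
      ∑ i, lam i * (p i * w.1 + q i * w.2 - c i) ^ 2) / 2))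
      ∂((gaussianReal 0 1).prod (gaussianReal 0 1)) ≤ ENNReal.ofReal (Real.sqrt (1 / a)) := by
  set t₀ := (∑ i, lam i * (p i * c i)) / a with ht₀
  set u₀ := ∑ i, lam i * (q i * c i) with hu₀
  have ht₁ : a * t₀ = ∑ i, lam i * (p i * c i) := by rw [ht₀]; field_simp
  -- `(t₀, u₀)` is the minimiser of the quadratic form
  have hle (w : ℝ × ℝ) : ENNReal.ofReal (Real.exp ((w.1 ^ 2 + w.2 ^ 2 - m * w.2 ^ 2 -
      ∑ i, lam i * (p i * w.1 + q i * w.2 - c i) ^ 2) / 2)) ≤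
      ENNReal.ofReal (Real.exp ((w.1 - 0) ^ 2 / (2 * 1) - (w.1 - t₀) ^ 2 / (2 * (1 / a)))) *
      ENNReal.ofReal (Real.exp ((w.2 - 0) ^ 2 / (2 * 1) - (w.2 - u₀) ^ 2 / (2 * 1))) := by
    rw [← ENNReal.ofReal_mul (Real.exp_nonneg _), ← Real.exp_add]
    refine ENNReal.ofReal_le_ofReal (Real.exp_le_exp.2 ?_)
    have hsq : m * w.2 ^ 2 + ∑ i, lam i * (p i * w.1 + q i * w.2 - c i) ^ 2 =
        a * (w.1 - t₀) ^ 2 + (w.2 - u₀) ^ 2 +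
          (m * u₀ ^ 2 + ∑ i, lam i * (p i * t₀ + q i * u₀ - c i) ^ 2) := by
      have hA := h.fst_fst
      have hB := h.fst_snd
      have hC := h.snd_snd
      simp only [Fin.sum_univ_two] at hA hB hC ht₁ hu₀ ⊢
      linear_combination (w.1 ^ 2 - t₀ ^ 2) * hA + 2 * (w.1 * w.2 - t₀ * u₀) * hB +
        (w.2 ^ 2 - u₀ ^ 2) * hC + 2 * (w.1 - t₀) * ht₁ + 2 * (w.2 - u₀) * hu₀
    have hnn : 0 ≤ m * u₀ ^ 2 + ∑ i, lam i * (p i * t₀ + q i * u₀ - c i) ^ 2 :=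
      add_nonneg (mul_nonneg h.m_nonneg (sq_nonneg _)) (Finset.sum_nonneg fun i _ =>
        mul_nonneg (h.lam_pos i).le (sq_nonneg _))
    have h1 : (w.1 - t₀) ^ 2 / (2 * (1 / a)) = a * (w.1 - t₀) ^ 2 / 2 := by field_simp
    rw [h1]
    linarith
  refine (lintegral_mono hle).trans_eq ?_
  rw [lintegral_prod_mul
    (f := fun t => ENNReal.ofReal
      (Real.exp ((t - 0) ^ 2 / (2 * 1) - (t - t₀) ^ 2 / (2 * (1 / a)))))
    (g := fun u => ENNReal.ofReal (Real.exp ((u - 0) ^ 2 / (2 * 1) - (u - u₀) ^ 2 / (2 * 1))))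
    (by fun_prop) (by fun_prop)]
  have e₁ := lintegral_exp_gaussianReal (x := 0) (y := t₀) one_pos (one_div_pos.2 ha)
  have e₂ := lintegral_exp_gaussianReal (x := 0) (y := u₀) one_pos one_pos
  rw [Real.toNNReal_one] at e₁ e₂
  rw [e₁, e₂]
  simp

/-- Reweighting the noise law turns the output `x + z` for a fixed input `x` into white noise of
variance `V`, whatever `x` is. -/
theorem lintegral_exp_shift {n : ℕ} {N V : ℝ} (hN : 0 < N) (hV : 0 < V)
    (x : Fin n → ℝ) {H : (Fin n → ℝ) → ℝ≥0∞} (hH : Measurable H) :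
    ∫⁻ z, (∏ k, ENNReal.ofReal (Real.sqrt (N / V) *
        Real.exp (z k ^ 2 / (2 * N) - (x k + z k) ^ 2 / (2 * V)))) * H (fun k => x k + z k)
      ∂(Measure.pi fun _ => gaussianReal 0 N.toNNReal) =
    ∫⁻ y, H y ∂(Measure.pi fun _ => gaussianReal 0 V.toNNReal) := by
  have hmap : (Measure.pi fun _ : Fin n => gaussianReal 0 N.toNNReal).map
      (fun z k => x k + z k) = Measure.pi fun k => gaussianReal (x k) N.toNNReal := by
    rw [Measure.pi_map_pi (f := fun k z => x k + z) fun k => by fun_prop]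
    simp [gaussianReal_map_const_add]
  have hf (k : Fin n) : Measurable fun t : ℝ => ENNReal.ofReal (Real.sqrt (N / V) *
      Real.exp ((t - x k) ^ 2 / (2 * N) - (t - 0) ^ 2 / (2 * V))) := by fun_prop
  have hd (k : Fin n) := gaussianReal_withDensity_exp (x := x k) (y := 0) hN hV
  have (k : Fin n) : SigmaFinite ((gaussianReal (x k) N.toNNReal).withDensity fun t : ℝ =>
      ENNReal.ofReal (Real.sqrt (N / V) *
        Real.exp ((t - x k) ^ 2 / (2 * N) - (t - 0) ^ 2 / (2 * V)))) := by
    rw [hd k]; infer_instance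
  have hpi := pi_withDensity_prod (fun k => gaussianReal (x k) N.toNNReal) hf
  simp_rw [hd] at hpi
  rw [← hpi, lintegral_withDensity_eq_lintegral_mul _ (by fun_prop) hH, ← hmap,
    lintegral_map (by fun_prop) (by fun_prop)]
  simp

/-- The exponent is the logarithm of the ratio between the comparison measure, with white output of
variance `V` and backward density given by the weights, and the true law of source and output. No
constant appears because the normalising factors `√(N / V)` of the output and of the backward density
cancel. -/
theorem BackwardWeights.lintegral_exp_le_one {n : ℕ} {N V m : ℝ} {p q lam : Fin 2 → ℝ}
    (hN : 0 < N) (hV : 0 < V) (h : BackwardWeights p q lam m (V / N))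
    {x : (Fin n → ℝ × ℝ) → Fin n → ℝ} (hx : Measurable x)
    {g : Fin 2 → (Fin n → ℝ) → Fin n → ℝ} (hg : ∀ i, Measurable (g i)) :
    ∫⁻ ω, ENNReal.ofReal (Real.exp (∑ k, (((ω.1 k).1 ^ 2 + (ω.1 k).2 ^ 2 - m * (ω.1 k).2 ^ 2 -
        ∑ i, lam i * (p i * (ω.1 k).1 + q i * (ω.1 k).2 -
          g i (fun j => x ω.1 j + ω.2 j) k) ^ 2) / 2 +
        (ω.2 k ^ 2 / (2 * N) - (x ω.1 k + ω.2 k) ^ 2 / (2 * V))))) ∂whiteLaw N n ≤ 1 := by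
  set A : ℝ × ℝ → (Fin 2 → ℝ) → ℝ := fun w c => (w.1 ^ 2 + w.2 ^ 2 - m * w.2 ^ 2 -
      ∑ i, lam i * (p i * w.1 + q i * w.2 - c i) ^ 2) / 2 with hA
  set r := ENNReal.ofReal (Real.sqrt (1 / (V / N)))
  have hgm (i : Fin 2) (k : Fin n) : Measurable fun y => g i y k := by
    have := hg i; fun_prop
  have hAm (w : Fin n → ℝ × ℝ) : Measurable fun y : Fin n → ℝ =>
      ∏ k, ENNReal.ofReal (Real.exp (A (w k) fun i => g i y k)) := by
    simp only [hA]; fun_prop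
  have hpt (w : Fin n → ℝ × ℝ) (z : Fin n → ℝ) :
      r ^ n * ENNReal.ofReal (Real.exp (∑ k, (A (w k) (fun i => g i (fun j => x w j + z j) k) +
        (z k ^ 2 / (2 * N) - (x w k + z k) ^ 2 / (2 * V))))) =
      (∏ k, ENNReal.ofReal (Real.sqrt (N / V) *
        Real.exp (z k ^ 2 / (2 * N) - (x w k + z k) ^ 2 / (2 * V)))) *
      ∏ k, ENNReal.ofReal (Real.exp (A (w k) fun i => g i (fun j => x w j + z j) k)) := by
    rw [Real.exp_sum, ENNReal.ofReal_prod_of_nonneg fun _ _ => Real.exp_nonneg _]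
    simp_rw [ENNReal.ofReal_mul (Real.sqrt_nonneg _), Real.exp_add,
      ENNReal.ofReal_mul (Real.exp_nonneg _), Finset.prod_mul_distrib]
    simp only [Finset.prod_const, Finset.card_univ, Fintype.card_fin, one_div_div, r]
    ring
  have hr : r ≠ 0 := by
    simp only [r, ne_eq, ENNReal.ofReal_eq_zero, not_le]
    positivity
  have hrn : r ^ n ≠ 0 := pow_ne_zero _ hr
  have hrt : r ^ n ≠ ∞ := ENNReal.pow_ne_top ENNReal.ofReal_ne_top
  have hmeas : Measurable fun ω : (Fin n → ℝ × ℝ) × (Fin n → ℝ) =>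
      ENNReal.ofReal (Real.exp (∑ k, (A (ω.1 k) (fun i => g i (fun j => x ω.1 j + ω.2 j) k) +
        (ω.2 k ^ 2 / (2 * N) - (x ω.1 k + ω.2 k) ^ 2 / (2 * V))))) := by
    have hout : Measurable fun ω : (Fin n → ℝ × ℝ) × (Fin n → ℝ) =>
        (fun j => x ω.1 j + ω.2 j) := by fun_prop
    have hgo (i : Fin 2) (k : Fin n) : Measurable fun ω : (Fin n → ℝ × ℝ) × (Fin n → ℝ) =>
        g i (fun j => x ω.1 j + ω.2 j) k := (hgm i k).comp hout
    simp only [hA]; fun_prop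
  have hm2 : Measurable fun wy : (Fin n → ℝ × ℝ) × (Fin n → ℝ) =>
      ∏ k, ENNReal.ofReal (Real.exp (A (wy.1 k) fun i => g i wy.2 k)) := by
    have hgo (i : Fin 2) (k : Fin n) : Measurable fun ω : (Fin n → ℝ × ℝ) × (Fin n → ℝ) =>
        g i ω.2 k := (hgm i k).comp measurable_snd
    simp only [hA]; fun_prop
  suffices hle : r ^ n * ∫⁻ ω, ENNReal.ofReal (Real.exp (∑ k,
      (A (ω.1 k) (fun i => g i (fun j => x ω.1 j + ω.2 j) k) +
        (ω.2 k ^ 2 / (2 * N) - (x ω.1 k + ω.2 k) ^ 2 / (2 * V))))) ∂whiteLaw N n ≤ r ^ n * 1 from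
    (ENNReal.mul_le_mul_iff_right hrn hrt).1 hle
  calc
    _ = ∫⁻ w, ∫⁻ z, (∏ k, ENNReal.ofReal (Real.sqrt (N / V) *
        Real.exp (z k ^ 2 / (2 * N) - (x w k + z k) ^ 2 / (2 * V)))) *
        ∏ k, ENNReal.ofReal (Real.exp (A (w k) fun i => g i (fun j => x w j + z j) k))
        ∂(Measure.pi fun _ => gaussianReal 0 N.toNNReal)
        ∂(Measure.pi fun _ => (gaussianReal 0 1).prod (gaussianReal 0 1)) := by
      rw [← lintegral_const_mul _ hmeas, whiteLaw, lintegral_prod _ (by fun_prop)]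
      simp_rw [hpt]
    _ = ∫⁻ w, ∫⁻ y, ∏ k, ENNReal.ofReal (Real.exp (A (w k) fun i => g i y k))
        ∂(Measure.pi fun _ => gaussianReal 0 V.toNNReal)
        ∂(Measure.pi fun _ => (gaussianReal 0 1).prod (gaussianReal 0 1)) :=
      lintegral_congr fun w => lintegral_exp_shift hN hV (x w) (hAm w)
    _ = ∫⁻ y, ∫⁻ w, ∏ k, ENNReal.ofReal (Real.exp (A (w k) fun i => g i y k))
        ∂(Measure.pi fun _ => (gaussianReal 0 1).prod (gaussianReal 0 1))
        ∂(Measure.pi fun _ => gaussianReal 0 V.toNNReal) :=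
      lintegral_lintegral_swap hm2.aemeasurable
    _ ≤ ∫⁻ _, r ^ n ∂(Measure.pi fun _ : Fin n => gaussianReal 0 V.toNNReal) := by
      refine lintegral_mono fun y => ?_
      rw [lintegral_pi_prod (fun _ : Fin n => (gaussianReal 0 1).prod (gaussianReal 0 1))
        (f := fun k w => ENNReal.ofReal (Real.exp (A w fun i => g i y k)))
        fun k => by simp only [hA]; fun_prop]
      calc _ ≤ ∏ _k : Fin n, r :=
            Finset.prod_le_prod' fun k _ => h.lintegral_le (by positivity) fun i => g i y k
        _ = r ^ n := by simp
    _ = r ^ n * 1 := by simp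

/-! ### Second moments and the weighted distortion bound -/

theorem memLp_add_prod {α β : Type*} [MeasurableSpace α] [MeasurableSpace β] {μ : Measure α}
    {ν : Measure β} [IsProbabilityMeasure μ] [IsProbabilityMeasure ν] {X : α → ℝ} {Z : β → ℝ}
    (hX : MemLp X 2 μ) (hZ : MemLp Z 2 ν) :
    MemLp (fun ω : α × β => X ω.1 + Z ω.2) 2 (μ.prod ν) :=
  (hX.comp_measurePreserving measurePreserving_fst).add
    (hZ.comp_measurePreserving measurePreserving_snd)

theorem integral_add_sq_prod {α β : Type*} [MeasurableSpace α] [MeasurableSpace β] {μ : Measure α}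
    {ν : Measure β} [IsProbabilityMeasure μ] [IsProbabilityMeasure ν] {X : α → ℝ} {Z : β → ℝ}
    (hX : MemLp X 2 μ) (hZ : MemLp Z 2 ν) (hZ₀ : ∫ b, Z b ∂ν = 0) :
    ∫ ω, (X ω.1 + Z ω.2) ^ 2 ∂(μ.prod ν) = ∫ a, X a ^ 2 ∂μ + ∫ b, Z b ^ 2 ∂ν := by
  have h1 : Integrable (fun ω : α × β => X ω.1 ^ 2) (μ.prod ν) :=
    (hX.comp_measurePreserving measurePreserving_fst).integrable_sq
  have h2 : Integrable (fun ω : α × β => Z ω.2 ^ 2) (μ.prod ν) :=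
    (hZ.comp_measurePreserving measurePreserving_snd).integrable_sq
  have h3 : Integrable (fun ω : α × β => X ω.1 * Z ω.2) (μ.prod ν) :=
    (hX.integrable one_le_two).mul_prod (hZ.integrable one_le_two)
  have h4 : Integrable (fun ω : α × β => X ω.1 ^ 2 + 2 * (X ω.1 * Z ω.2)) (μ.prod ν) :=
    h1.add (h3.const_mul 2)
  have e (ω : α × β) : (X ω.1 + Z ω.2) ^ 2 = X ω.1 ^ 2 + 2 * (X ω.1 * Z ω.2) + Z ω.2 ^ 2 := by
    ring
  simp_rw [e]
  rw [integral_add h4 h2, integral_add h1 (h3.const_mul 2),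
    integral_const_mul, integral_prod_mul, hZ₀, integral_fun_fst (fun a => X a ^ 2),
    integral_fun_snd (fun b => Z b ^ 2)]
  simp

theorem integral_sq_gaussianReal (v : NNReal) : ∫ z, z ^ 2 ∂gaussianReal 0 v = v := by
  have h := variance_fun_id_gaussianReal (μ := 0) (v := v)
  rwa [variance_of_integral_eq_zero aemeasurable_id' (by simp)] at h

theorem integral_const_mul_sq_gaussianReal (c : ℝ) (v : NNReal) :
    ∫ z, (c * z) ^ 2 ∂gaussianReal 0 v = c ^ 2 * v := by
  simp_rw [mul_pow]
  rw [integral_const_mul, integral_sq_gaussianReal]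

theorem memLp_const_mul_gaussianReal (c : ℝ) (v : NNReal) :
    MemLp (fun z => c * z) 2 (gaussianReal 0 v) :=
  (memLp_id_gaussianReal' 2 (by simp)).const_mul c

section whiteLaw

variable {n : ℕ} {N : ℝ}

theorem memLp_pi_linear (a b : ℝ) (k : Fin n) :
    MemLp (fun w : Fin n → ℝ × ℝ => a * (w k).1 + b * (w k).2) 2
      (Measure.pi fun _ => (gaussianReal 0 1).prod (gaussianReal 0 1)) :=
  (memLp_add_prod (memLp_const_mul_gaussianReal a 1)
    (memLp_const_mul_gaussianReal b 1)).comp_measurePreserving (measurePreserving_eval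
      (fun _ : Fin n => (gaussianReal 0 1).prod (gaussianReal 0 1)) k)

theorem integral_pi_linear_sq (a b : ℝ) (k : Fin n) :
    ∫ w, (a * (w k).1 + b * (w k).2) ^ 2
      ∂(Measure.pi fun _ : Fin n => (gaussianReal 0 1).prod (gaussianReal 0 1)) =
      a ^ 2 + b ^ 2 := by
  have h := integral_add_sq_prod (memLp_const_mul_gaussianReal a 1)
    (memLp_const_mul_gaussianReal b 1)
    (by rw [integral_const_mul, integral_id_gaussianReal, mul_zero])
  rw [integral_const_mul_sq_gaussianReal, integral_const_mul_sq_gaussianReal,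
    ← (measurePreserving_eval (fun _ : Fin n => (gaussianReal 0 1).prod (gaussianReal 0 1))
      k).map_eq, integral_map (measurable_pi_apply k).aemeasurable
      (Measurable.aestronglyMeasurable (by fun_prop))] at h
  simpa using h

theorem memLp_pi_noise (c : ℝ) (k : Fin n) :
    MemLp (fun z : Fin n → ℝ => c * z k) 2 (Measure.pi fun _ => gaussianReal 0 N.toNNReal) :=
  (memLp_const_mul_gaussianReal c _).comp_measurePreserving
    (measurePreserving_eval (fun _ : Fin n => gaussianReal 0 N.toNNReal) k)

theorem integral_pi_noise (c : ℝ) (k : Fin n) :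
    ∫ z, c * z k ∂(Measure.pi fun _ : Fin n => gaussianReal 0 N.toNNReal) = 0 := by
  rw [integral_const_mul, integral_comp_eval (μ := fun _ : Fin n => gaussianReal 0 N.toNNReal)
    (f := fun z : ℝ => z) (by fun_prop), integral_id_gaussianReal, mul_zero]

theorem integral_pi_noise_sq (hN : 0 < N) (c : ℝ) (k : Fin n) :
    ∫ z, (c * z k) ^ 2 ∂(Measure.pi fun _ : Fin n => gaussianReal 0 N.toNNReal) =
      c ^ 2 * N := by
  rw [integral_comp_eval (μ := fun _ : Fin n => gaussianReal 0 N.toNNReal)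
    (f := fun z : ℝ => (c * z) ^ 2) (by fun_prop),
    integral_const_mul_sq_gaussianReal, Real.coe_toNNReal _ hN.le]

theorem memLp_whiteLaw_linear (a b c : ℝ) (k : Fin n) :
    MemLp (fun ω : (Fin n → ℝ × ℝ) × (Fin n → ℝ) =>
      a * (ω.1 k).1 + b * (ω.1 k).2 + c * ω.2 k) 2 (whiteLaw N n) :=
  memLp_add_prod (memLp_pi_linear a b k) (memLp_pi_noise c k)

theorem integral_whiteLaw_linear_sq (hN : 0 < N) (a b c : ℝ) (k : Fin n) :
    ∫ ω, (a * (ω.1 k).1 + b * (ω.1 k).2 + c * ω.2 k) ^ 2 ∂whiteLaw N n =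
      a ^ 2 + b ^ 2 + c ^ 2 * N := by
  have h := integral_add_sq_prod (memLp_pi_linear a b k) (memLp_pi_noise (N := N) c k)
    (integral_pi_noise c k)
  rwa [integral_pi_linear_sq, integral_pi_noise_sq hN] at h

/-- The linear bound on the distortions, in white coordinates: the log-likelihood ratio `∑ k, G k`
has nonpositive expectation, and the output power is at most `P + N` per letter on average. -/
theorem BackwardWeights.le_sum_integral {V m P : ℝ} {p q lam : Fin 2 → ℝ}
    (hN : 0 < N) (hP : 0 < P) (h : BackwardWeights p q lam m (V / N)) (hV : V = P + N)
    {x : (Fin n → ℝ × ℝ) → Fin n → ℝ} (hx : Measurable x)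
    (hx₂ : ∀ k, MemLp (fun w => x w k) 2
      (Measure.pi fun _ => (gaussianReal 0 1).prod (gaussianReal 0 1)))
    (hpow : ∑ k, ∫ w, x w k ^ 2 ∂(Measure.pi fun _ => (gaussianReal 0 1).prod (gaussianReal 0 1))
      ≤ n * P)
    {g : Fin 2 → (Fin n → ℝ) → Fin n → ℝ} (hg : ∀ i, Measurable (g i))
    (hint : ∀ i k, Integrable (fun ω => (p i * (ω.1 k).1 + q i * (ω.1 k).2 -
      g i (fun j => x ω.1 j + ω.2 j) k) ^ 2) (whiteLaw N n)) :
    n * (2 - m) ≤ ∑ i, lam i * ∑ k, ∫ ω, (p i * (ω.1 k).1 + q i * (ω.1 k).2 -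
      g i (fun j => x ω.1 j + ω.2 j) k) ^ 2 ∂whiteLaw N n := by
  have hV₀ : 0 < V := by rw [hV]; positivity
  have hT (k : Fin n) : Integrable (fun ω => (ω.1 k).1 ^ 2) (whiteLaw N n) := by
    simpa using (memLp_whiteLaw_linear (N := N) 1 0 0 k).integrable_sq
  have hU (k : Fin n) : Integrable (fun ω => (ω.1 k).2 ^ 2) (whiteLaw N n) := by
    simpa using (memLp_whiteLaw_linear (N := N) 0 1 0 k).integrable_sq
  have hZ (k : Fin n) : Integrable (fun ω => ω.2 k ^ 2) (whiteLaw N n) := by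
    simpa using (memLp_whiteLaw_linear (N := N) 0 0 1 k).integrable_sq
  have eT (k : Fin n) : ∫ ω, (ω.1 k).1 ^ 2 ∂whiteLaw N n = 1 := by
    simpa using integral_whiteLaw_linear_sq hN 1 0 0 k
  have eU (k : Fin n) : ∫ ω, (ω.1 k).2 ^ 2 ∂whiteLaw N n = 1 := by
    simpa using integral_whiteLaw_linear_sq hN 0 1 0 k
  have eZ (k : Fin n) : ∫ ω, ω.2 k ^ 2 ∂whiteLaw N n = N := by
    simpa using integral_whiteLaw_linear_sq hN 0 0 1 k
  have hz (k : Fin n) : MemLp (fun z : Fin n → ℝ => z k) 2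
      (Measure.pi fun _ => gaussianReal 0 N.toNNReal) := by
    simpa using memLp_pi_noise (N := N) 1 k
  have hY (k : Fin n) : Integrable (fun ω => (x ω.1 k + ω.2 k) ^ 2) (whiteLaw N n) :=
    (memLp_add_prod (hx₂ k) (hz k)).integrable_sq
  have eY (k : Fin n) : ∫ ω, (x ω.1 k + ω.2 k) ^ 2 ∂whiteLaw N n =
      ∫ w, x w k ^ 2 ∂(Measure.pi fun _ => (gaussianReal 0 1).prod (gaussianReal 0 1)) + N := by
    have h1 := integral_add_sq_prod (hx₂ k) (hz k)
      (by simpa using integral_pi_noise (N := N) 1 k)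
    have h2 : ∫ z, z k ^ 2 ∂(Measure.pi fun _ : Fin n => gaussianReal 0 N.toNNReal) = N := by
      simpa using integral_pi_noise_sq hN 1 k
    rwa [h2] at h1
  set E : Fin 2 → Fin n → (Fin n → ℝ × ℝ) × (Fin n → ℝ) → ℝ := fun i k ω =>
    (p i * (ω.1 k).1 + q i * (ω.1 k).2 - g i (fun j => x ω.1 j + ω.2 j) k) ^ 2 with hE
  set G : Fin n → (Fin n → ℝ × ℝ) × (Fin n → ℝ) → ℝ := fun k ω =>
    ((ω.1 k).1 ^ 2 + (ω.1 k).2 ^ 2 - m * (ω.1 k).2 ^ 2 - ∑ i, lam i * E i k ω) / 2 +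
      (ω.2 k ^ 2 / (2 * N) - (x ω.1 k + ω.2 k) ^ 2 / (2 * V)) with hG
  have hG₁ (k : Fin n) : Integrable (fun ω => (ω.1 k).1 ^ 2 + (ω.1 k).2 ^ 2 -
      m * (ω.1 k).2 ^ 2) (whiteLaw N n) := ((hT k).add (hU k)).sub ((hU k).const_mul m)
  have hG₂ (k : Fin n) : Integrable (fun ω => ∑ i, lam i * E i k ω) (whiteLaw N n) :=
    integrable_finsetSum _ fun i _ => (hint i k).const_mul _
  have hG₃ (k : Fin n) : Integrable (fun ω => ((ω.1 k).1 ^ 2 + (ω.1 k).2 ^ 2 -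
      m * (ω.1 k).2 ^ 2 - ∑ i, lam i * E i k ω) / 2) (whiteLaw N n) :=
    ((hG₁ k).sub (hG₂ k)).div_const 2
  have hG₄ (k : Fin n) : Integrable (fun ω => ω.2 k ^ 2 / (2 * N) -
      (x ω.1 k + ω.2 k) ^ 2 / (2 * V)) (whiteLaw N n) :=
    ((hZ k).div_const _).sub ((hY k).div_const _)
  have hG₅ (k : Fin n) : Integrable (fun ω => (ω.1 k).1 ^ 2 + (ω.1 k).2 ^ 2) (whiteLaw N n) :=
    (hT k).add (hU k)
  have hGint (k : Fin n) : Integrable (G k) (whiteLaw N n) := (hG₃ k).add (hG₄ k)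
  have eG (k : Fin n) : ∫ ω, G k ω ∂whiteLaw N n =
      (2 - m - ∑ i, lam i * ∫ ω, E i k ω ∂whiteLaw N n) / 2 + (N / (2 * N) -
        (∫ w, x w k ^ 2 ∂(Measure.pi fun _ => (gaussianReal 0 1).prod (gaussianReal 0 1)) + N) /
          (2 * V)) := by
    simp only [hG]
    rw [integral_add (hG₃ k) (hG₄ k), integral_div,
      integral_sub (hG₁ k) (hG₂ k), integral_sub (hG₅ k) ((hU k).const_mul m),
      integral_add (hT k) (hU k), integral_const_mul, integral_sub ((hZ k).div_const _)
      ((hY k).div_const _), integral_div, integral_div, eT, eU, eZ, eY,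
      integral_finsetSum _ fun i _ => (hint i k).const_mul _]
    simp_rw [integral_const_mul]
    ring
  have hSint : Integrable (fun ω => ∑ k, G k ω) (whiteLaw N n) :=
    integrable_finsetSum _ fun k _ => hGint k
  have hmain : ∫ ω, ∑ k, G k ω ∂whiteLaw N n ≤ 0 := by
    have hle := h.lintegral_exp_le_one hN hV₀ hx hg
    have hexp : Integrable (fun ω => Real.exp (∑ k, G k ω)) (whiteLaw N n) :=
      ⟨(Real.continuous_exp.comp_aestronglyMeasurable hSint.1), by
        rw [hasFiniteIntegral_iff_ofReal (Eventually.of_forall fun _ => Real.exp_nonneg _)]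
        exact hle.trans_lt ENNReal.one_lt_top⟩
    have h1 : ∫ ω, Real.exp (∑ k, G k ω) ∂whiteLaw N n ≤ 1 := by
      rw [integral_eq_lintegral_of_nonneg_ae (Eventually.of_forall fun _ => Real.exp_nonneg _)
        hexp.1]
      exact ENNReal.toReal_le_of_le_ofReal zero_le_one (by rw [ENNReal.ofReal_one]; exact hle)
    have h2 : ∫ ω, (∑ k, G k ω + 1) ∂whiteLaw N n ≤ ∫ ω, Real.exp (∑ k, G k ω) ∂whiteLaw N n :=
      integral_mono (hSint.add (integrable_const 1)) hexp fun ω => Real.add_one_le_exp _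
    rw [integral_add hSint (integrable_const 1)] at h2
    simp at h2
    linarith
  rw [integral_finsetSum _ fun k _ => hGint k] at hmain
  simp_rw [eG] at hmain
  have hsum : ∑ i, lam i * ∑ k, ∫ ω, E i k ω ∂whiteLaw N n =
      ∑ k, ∑ i, lam i * ∫ ω, E i k ω ∂whiteLaw N n := by
    simp_rw [Finset.mul_sum]
    exact Finset.sum_comm
  rw [hsum]
  rw [Finset.sum_add_distrib, Finset.sum_sub_distrib, ← Finset.sum_div, Finset.sum_sub_distrib,
    ← Finset.sum_div, Finset.sum_sub_distrib, ← Finset.sum_div, Finset.sum_add_distrib] at hmain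
  simp only [Finset.sum_const, Finset.card_univ, Fintype.card_fin, nsmul_eq_mul] at hmain
  have h3 : (∑ k, ∫ w, x w k ^ 2
      ∂(Measure.pi fun _ => (gaussianReal 0 1).prod (gaussianReal 0 1)) + n * N) / (2 * V) ≤
      n / 2 := by
    rw [div_le_div_iff₀ (by positivity) two_pos, hV]
    linarith
  have h4 : (n : ℝ) * N / (2 * N) = n / 2 := by field_simp
  rw [h4] at hmain
  linarith

end whiteLaw

/-! ### The weighted bound for sequences of schemes -/

/-- The outcome of the link whose source components are `p i * T + q i * U` at each time, with the
given noise. -/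
noncomputable def outcomeOfWhite {n : ℕ} (p q : Fin 2 → ℝ)
    (ω : (Fin n → ℝ × ℝ) × (Fin n → ℝ)) : Outcome n :=
  (fun k => WithLp.toLp 2 fun i => p i * (ω.1 k).1 + q i * (ω.1 k).2, ω.2)

theorem source_outcomeOfWhite {n : ℕ} (p q : Fin 2 → ℝ) (ω : (Fin n → ℝ × ℝ) × (Fin n → ℝ))
    (i : Fin 2) (k : Fin n) :
    source i (outcomeOfWhite p q ω) k = p i * (ω.1 k).1 + q i * (ω.1 k).2 := rfl

theorem measurePreserving_outcomeOfWhite {v ρ : ℝ} {p q : Fin 2 → ℝ}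
    (hv : ∀ i, p i ^ 2 + q i ^ 2 = v) (hρ : p 0 * p 1 + q 0 * q 1 = v * ρ) (N : ℝ) (n : ℕ) :
    MeasurePreserving (outcomeOfWhite p q) (whiteLaw N n) (linkLaw v ρ N n) := by
  have hm : Measurable fun w : ℝ × ℝ =>
      (WithLp.toLp 2 fun i => p i * w.1 + q i * w.2 : EuclideanSpace ℝ (Fin 2)) := by fun_prop
  refine ⟨by unfold outcomeOfWhite; fun_prop, ?_⟩
  have h1 : (Measure.pi fun _ : Fin n => (gaussianReal 0 1).prod (gaussianReal 0 1)).map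
      (fun w k => (WithLp.toLp 2 fun i => p i * (w k).1 + q i * (w k).2 :
        EuclideanSpace ℝ (Fin 2))) = Measure.pi fun _ => sourceLaw v ρ := by
    have (k : Fin n) : SigmaFinite (((gaussianReal 0 1).prod (gaussianReal 0 1)).map
        fun w : ℝ × ℝ => (WithLp.toLp 2 fun i => p i * w.1 + q i * w.2 :
          EuclideanSpace ℝ (Fin 2))) := by
      rw [← sourceLaw_eq_map hv hρ]; infer_instance
    rw [sourceLaw_eq_map hv hρ]
    exact Measure.pi_map_pi fun _ => hm.aemeasurable
  unfold linkLaw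
  rw [← h1]
  have h2 := Measure.map_prod_map
    (Measure.pi fun _ : Fin n => (gaussianReal 0 1).prod (gaussianReal 0 1))
    (Measure.pi fun _ : Fin n => gaussianReal 0 N.toNNReal)
    (f := fun w k => (WithLp.toLp 2 fun i => p i * (w k).1 + q i * (w k).2 :
        EuclideanSpace ℝ (Fin 2))) (g := id) (by fun_prop) measurable_id
  rw [Measure.map_id] at h2
  exact h2.symm

theorem measurable_source {n : ℕ} (i : Fin 2) :
    Measurable (source i : Outcome n → Fin n → ℝ) := by
  unfold source; fun_prop

theorem measurable_input {n : ℕ} {f : Encoder n}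
    (hf : Measurable fun s : (Fin n → ℝ) × (Fin n → ℝ) => f s.1 s.2) : Measurable (input f) :=
  hf.comp ((measurable_source 0).prodMk (measurable_source 1))

theorem measurable_output {n : ℕ} {f : Encoder n}
    (hf : Measurable fun s : (Fin n → ℝ) × (Fin n → ℝ) => f s.1 s.2) : Measurable (output f) := by
  have := measurable_input hf
  unfold output
  fun_prop

theorem integrable_sq_of_sum_lintegral_ne_top {Ω : Type*} [MeasurableSpace Ω] {μ : Measure Ω}
    {n : ℕ} {F : Fin n → Ω → ℝ} (hF : ∀ k, Measurable (F k))
    (h : ∑ k, ∫⁻ ω, ENNReal.ofReal (F k ω ^ 2) ∂μ ≠ ∞) (k : Fin n) :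
    Integrable (fun ω => F k ω ^ 2) μ :=
  (lintegral_ofReal_ne_top_iff_integrable ((hF k).pow_const 2).aestronglyMeasurable
    (Eventually.of_forall fun _ => sq_nonneg _)).1
    ((ENNReal.sum_ne_top.1 h) k (Finset.mem_univ k))

theorem sum_lintegral_ofReal_sq {Ω : Type*} [MeasurableSpace Ω] {μ : Measure Ω}
    {n : ℕ} {F : Fin n → Ω → ℝ} (hF : ∀ k, Integrable (fun ω => F k ω ^ 2) μ) :
    ∑ k, ∫⁻ ω, ENNReal.ofReal (F k ω ^ 2) ∂μ = ENNReal.ofReal (∑ k, ∫ ω, F k ω ^ 2 ∂μ) := by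
  rw [ENNReal.ofReal_sum_of_nonneg fun k _ => integral_nonneg fun _ => sq_nonneg _]
  exact Finset.sum_congr rfl fun k _ =>
    (ofReal_integral_eq_lintegral_ofReal (hF k) (Eventually.of_forall fun _ => sq_nonneg _)).symm

/-- The linear bound on the distortions of one scheme of positive blocklength. -/
theorem BackwardWeights.le_averageDistortion {n : ℕ} (hn : n ≠ 0) {v ρ P N m : ℝ}
    {p q lam : Fin 2 → ℝ} (hP : 0 < P) (hN : 0 < N) (h : BackwardWeights p q lam m ((P + N) / N))
    (hv : ∀ i, p i ^ 2 + q i ^ 2 = v) (hρ : p 0 * p 1 + q 0 * q 1 = v * ρ)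
    {f : Encoder n} (hf : Measurable fun s : (Fin n → ℝ) × (Fin n → ℝ) => f s.1 s.2)
    {g : Fin 2 → (Fin n → ℝ) → Fin n → ℝ} (hg : ∀ i, Measurable (g i))
    (hpow : averagePower v ρ N f ≤ ENNReal.ofReal P) {d : Fin 2 → ℝ}
    (hd : ∀ i, averageDistortion v ρ N f (g i) i ≤ ENNReal.ofReal (d i)) (hd₀ : ∀ i, 0 ≤ d i) :
    2 - m ≤ ∑ i, lam i * d i := by
  have hn₀ : (n : ℝ≥0∞) ≠ 0 := by exact_mod_cast hn
  have hn₁ : (0 : ℝ) < n := by positivity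
  have hnt : (n : ℝ≥0∞) ≠ ∞ := ENNReal.natCast_ne_top n
  have hmp := measurePreserving_outcomeOfWhite hv hρ N n
  set x : (Fin n → ℝ × ℝ) → Fin n → ℝ := fun w =>
    f (fun k => p 0 * (w k).1 + q 0 * (w k).2) (fun k => p 1 * (w k).1 + q 1 * (w k).2) with hxdef
  have hx : Measurable x :=
    hf.comp (g := fun s : (Fin n → ℝ) × (Fin n → ℝ) => f s.1 s.2)
      (f := fun w : Fin n → ℝ × ℝ => ((fun k => p 0 * (w k).1 + q 0 * (w k).2),
        (fun k => p 1 * (w k).1 + q 1 * (w k).2))) (by fun_prop)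
  have hxk (k : Fin n) : Measurable fun w => x w k := by fun_prop
  have hin := measurable_input hf
  have hout := measurable_output hf
  -- the power constraint in white coordinates
  have hpowsum : ∑ k, ∫⁻ w, ENNReal.ofReal (x w k ^ 2)
      ∂(Measure.pi fun _ => (gaussianReal 0 1).prod (gaussianReal 0 1)) ≤
      ENNReal.ofReal (n * P) := by
    rw [averagePower, ENNReal.div_le_iff hn₀ hnt] at hpow
    have hin' (k : Fin n) : Measurable fun ω => ENNReal.ofReal (input f ω k ^ 2) := by fun_prop
    rw [ENNReal.ofReal_mul hn₁.le, ENNReal.ofReal_natCast, mul_comm]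
    refine le_of_eq_of_le (Finset.sum_congr rfl fun k _ => ?_) hpow
    rw [← hmp.lintegral_comp (hin' k)]
    have hfst : MeasurePreserving Prod.fst (whiteLaw N n)
        (Measure.pi fun _ : Fin n => (gaussianReal 0 1).prod (gaussianReal 0 1)) :=
      measurePreserving_fst
    exact (hfst.lintegral_comp (f := fun w => ENNReal.ofReal (x w k ^ 2)) (by fun_prop)).symm
  have hx₂ := integrable_sq_of_sum_lintegral_ne_top hxk
    (hpowsum.trans_lt ENNReal.ofReal_lt_top).ne
  have hpow' : ∑ k, ∫ w, x w k ^ 2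
      ∂(Measure.pi fun _ => (gaussianReal 0 1).prod (gaussianReal 0 1)) ≤ n * P := by
    rw [sum_lintegral_ofReal_sq hx₂] at hpowsum
    exact (ENNReal.ofReal_le_ofReal_iff (by positivity)).1 hpowsum
  -- the distortions in white coordinates
  set F : Fin 2 → Fin n → (Fin n → ℝ × ℝ) × (Fin n → ℝ) → ℝ := fun i k ω =>
    p i * (ω.1 k).1 + q i * (ω.1 k).2 - g i (fun j => x ω.1 j + ω.2 j) k
  have hF (i : Fin 2) (k : Fin n) : Measurable (F i k) := by
    have h1 : Measurable fun ω : (Fin n → ℝ × ℝ) × (Fin n → ℝ) =>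
      g i (fun j => x ω.1 j + ω.2 j) := (hg i).comp (by fun_prop)
    fun_prop
  have hdsum (i : Fin 2) : ∑ k, ∫⁻ ω, ENNReal.ofReal (F i k ω ^ 2) ∂whiteLaw N n ≤
      ENNReal.ofReal (n * d i) := by
    have hdi := hd i
    rw [averageDistortion, ENNReal.div_le_iff hn₀ hnt] at hdi
    rw [ENNReal.ofReal_mul hn₁.le, ENNReal.ofReal_natCast, mul_comm]
    refine le_of_eq_of_le (Finset.sum_congr rfl fun k _ => ?_) hdi
    have hgo : Measurable fun ω => g i (output f ω) := (hg i).comp hout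
    have hs := measurable_source (n := n) i
    rw [← hmp.lintegral_comp (f := fun ω =>
      ENNReal.ofReal ((source i ω k - g i (output f ω) k) ^ 2)) (by fun_prop)]
    rfl
  have hF₂ (i : Fin 2) := integrable_sq_of_sum_lintegral_ne_top (hF i)
    ((hdsum i).trans_lt ENNReal.ofReal_lt_top).ne
  have hd' (i : Fin 2) : ∑ k, ∫ ω, F i k ω ^ 2 ∂whiteLaw N n ≤ n * d i := by
    have h1 := hdsum i
    rw [sum_lintegral_ofReal_sq (hF₂ i)] at h1
    exact (ENNReal.ofReal_le_ofReal_iff (mul_nonneg hn₁.le (hd₀ i))).1 h1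
  have hfinal := h.le_sum_integral hN hP rfl hx
    (fun k => (memLp_two_iff_integrable_sq (hxk k).aestronglyMeasurable).2 (hx₂ k)) hpow' hg hF₂
  refine le_of_mul_le_mul_left (hfinal.trans ?_) hn₁
  rw [Finset.mul_sum]
  refine Finset.sum_le_sum fun i _ => ?_
  rw [mul_left_comm]
  exact mul_le_mul_of_nonneg_left (hd' i) (h.lam_pos i).le

theorem BackwardWeights.le_of_achieves {v ρ P N m D₁ D₂ : ℝ}
    {p q lam : Fin 2 → ℝ} (hP : 0 < P) (hN : 0 < N) (h : BackwardWeights p q lam m ((P + N) / N))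
    (hv : ∀ i, p i ^ 2 + q i ^ 2 = v) (hρ : p 0 * p 1 + q 0 * q 1 = v * ρ)
    {c : Scheme} (hc : c.Achieves v ρ P N D₁ D₂) :
    2 - m ≤ lam 0 * D₁ + lam 1 * D₂ := by
  have hsum : 0 < lam 0 + lam 1 := add_pos (h.lam_pos 0) (h.lam_pos 1)
  refine le_of_forall_pos_le_add fun ε hε => ?_
  set η := ε / (lam 0 + lam 1) with hη
  have hη₀ : 0 < η := div_pos hε hsum
  have h1 : ∀ᶠ n in atTop, averageDistortion v ρ N (c.enc n) (c.est 0 n) 0 <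
      ENNReal.ofReal (D₁ + η) :=
    eventually_lt_of_limsup_lt (hc.distortion₁.trans_lt
      ((ENNReal.ofReal_lt_ofReal_iff (by linarith [hc.nonneg₁])).2 (by linarith)))
  have h2 : ∀ᶠ n in atTop, averageDistortion v ρ N (c.enc n) (c.est 1 n) 1 <
      ENNReal.ofReal (D₂ + η) :=
    eventually_lt_of_limsup_lt (hc.distortion₂.trans_lt
      ((ENNReal.ofReal_lt_ofReal_iff (by linarith [hc.nonneg₂])).2 (by linarith)))
  obtain ⟨n, hn1, hn2, hn⟩ := (h1.and (h2.and (eventually_ne_atTop 0))).exists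
  have h3 := h.le_averageDistortion hn hP hN hv hρ (hc.measurable_enc n)
    (g := fun i => c.est i n) (fun i => hc.measurable_est i n) (hc.power n)
    (d := ![D₁ + η, D₂ + η])
    (by simpa [Fin.forall_fin_two] using ⟨hn1.le, hn2.le⟩)
    (by simpa [Fin.forall_fin_two] using
      ⟨add_nonneg hc.nonneg₁ hη₀.le, add_nonneg hc.nonneg₂ hη₀.le⟩)
  have h4 : (lam 0 + lam 1) * η = ε := mul_div_cancel₀ _ hsum.ne'
  simp [Fin.sum_univ_two] at h3
  linarith

/-! ### The distortions of the uncoded scheme -/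

/-- The conditional expectation has the least mean squared error among `m`-measurable estimates. -/
theorem integral_sq_sub_condExp_le {Ω : Type*} {m mΩ : MeasurableSpace Ω} {μ : Measure Ω}
    [IsProbabilityMeasure μ] (hm : m ≤ mΩ) {S W : Ω → ℝ} (hS : MemLp S 2 μ) (hW : MemLp W 2 μ)
    (hWm : StronglyMeasurable[m] W) :
    ∫ ω, (S ω - (μ[S | m]) ω) ^ 2 ∂μ ≤ ∫ ω, (S ω - W ω) ^ 2 ∂μ := by
  have hce : μ[S - W | m] =ᵐ[μ] μ[S | m] - W := by
    filter_upwards [condExp_sub (hS.integrable one_le_two) (hW.integrable one_le_two) m] with ω h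
    rw [h, Pi.sub_apply, condExp_of_stronglyMeasurable hm hWm (hW.integrable one_le_two),
      Pi.sub_apply]
  have h := integral_mono_ae integrable_condVar integrable_condExp
    (condVar_ae_le_condExp_sq hm (hS.sub hW))
  unfold condVar at h
  rw [integral_condExp hm, integral_condExp hm] at h
  refine le_of_eq_of_le (integral_congr_ae ?_) h
  filter_upwards [hce] with ω hω
  simp [hω]

theorem lintegral_sq_sub_condMean_le {Ω : Type*} [MeasurableSpace Ω] {μ : Measure Ω}
    [IsProbabilityMeasure μ] {S Y : Ω → ℝ} (hY : Measurable Y)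
    (hS₂ : MemLp S 2 μ) (hY₂ : MemLp Y 2 μ) (c : ℝ) :
    ∫⁻ ω, ENNReal.ofReal ((S ω - ∫ s, s ∂(condDistrib S Y μ (Y ω))) ^ 2) ∂μ ≤
      ENNReal.ofReal (∫ ω, (S ω - c * Y ω) ^ 2 ∂μ) := by
  have hle := integral_sq_sub_condExp_le hY.comap_le hS₂ (hY₂.const_mul c)
    ((comap_measurable Y).const_mul c).stronglyMeasurable
  have hint : Integrable (fun ω => (S ω - (μ[S | MeasurableSpace.comap Y inferInstance]) ω) ^ 2)
      μ := (hS₂.sub (hS₂.condExp one_le_two)).integrable_sq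
  refine le_trans (le_of_eq ?_) (ENNReal.ofReal_le_ofReal hle)
  rw [ofReal_integral_eq_lintegral_ofReal hint (Eventually.of_forall fun _ => sq_nonneg _)]
  refine lintegral_congr_ae ?_
  filter_upwards [condExp_ae_eq_integral_condDistrib' hY (hS₂.integrable one_le_two)] with ω hω
  rw [hω]

/-- In coordinates where the uncoded input is `√P * T`, the conditional-mean estimates are compared
with the linear ones, whose errors are computed from second moments. -/
theorem uncodedScheme_achieves {v ρ P N α β : ℝ} {p q : Fin 2 → ℝ} (hP : 0 < P) (hN : 0 < N)
    (hv : ∀ i, p i ^ 2 + q i ^ 2 = v) (hρ : p 0 * p 1 + q 0 * q 1 = v * ρ)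
    (hp : Real.sqrt (P / (v * (α ^ 2 + 2 * α * β * ρ + β ^ 2))) * (α * p 0 + β * p 1) =
      Real.sqrt P) (hq : α * q 0 + β * q 1 = 0) :
    (uncodedScheme v ρ P N α β).Achieves v ρ P N (p 0 ^ 2 * (N / (P + N)) + q 0 ^ 2)
      (p 1 ^ 2 * (N / (P + N)) + q 1 ^ 2) := by
  have henc (n : ℕ) : Measurable fun s : (Fin n → ℝ) × (Fin n → ℝ) =>
      uncodedEncoder v ρ P α β n s.1 s.2 := by
    unfold uncodedEncoder; fun_prop
  have hinput {n : ℕ} (ω : (Fin n → ℝ × ℝ) × (Fin n → ℝ)) (k : Fin n) :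
      input (uncodedEncoder v ρ P α β n) (outcomeOfWhite p q ω) k =
        Real.sqrt P * (ω.1 k).1 := by
    simp only [input, uncodedEncoder, source_outcomeOfWhite]
    rw [← hp]
    linear_combination Real.sqrt (P / (v * (α ^ 2 + 2 * α * β * ρ + β ^ 2))) * (ω.1 k).2 * hq
  have hpow (n : ℕ) : averagePower v ρ N (uncodedEncoder v ρ P α β n) ≤ ENNReal.ofReal P := by
    refine ENNReal.div_le_of_le_mul ?_
    have hk (k : Fin n) : ∫⁻ ω, ENNReal.ofReal (input (uncodedEncoder v ρ P α β n) ω k ^ 2)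
        ∂linkLaw v ρ N n = ENNReal.ofReal P := by
      have hin := measurable_input (henc n)
      rw [← (measurePreserving_outcomeOfWhite hv hρ N n).lintegral_comp
        (f := fun ω => ENNReal.ofReal (input (uncodedEncoder v ρ P α β n) ω k ^ 2)) (by fun_prop)]
      simp_rw [hinput]
      have h1 := (memLp_whiteLaw_linear (N := N) (Real.sqrt P) 0 0 k).integrable_sq
      have h2 := integral_whiteLaw_linear_sq hN (Real.sqrt P) 0 0 k
      simp only [zero_mul, add_zero] at h1 h2
      rw [← ofReal_integral_eq_lintegral_ofReal h1 (Eventually.of_forall fun _ => sq_nonneg _), h2,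
        Real.sq_sqrt hP.le]
      simp
    simp_rw [hk]
    simp [mul_comm]
  have hdist (i : Fin 2) (n : ℕ) : averageDistortion v ρ N (uncodedEncoder v ρ P α β n)
      ((uncodedScheme v ρ P N α β).est i n) i ≤
        ENNReal.ofReal (p i ^ 2 * (N / (P + N)) + q i ^ 2) := by
    refine ENNReal.div_le_of_le_mul ?_
    have hmp := measurePreserving_outcomeOfWhite hv hρ N n
    have hk (k : Fin n) : ∫⁻ ω, ENNReal.ofReal ((source i ω k -
        (uncodedScheme v ρ P N α β).est i n (output (uncodedEncoder v ρ P α β n) ω) k) ^ 2)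
        ∂linkLaw v ρ N n ≤ ENNReal.ofReal (p i ^ 2 * (N / (P + N)) + q i ^ 2) := by
      have hout := measurable_output (henc n)
      have hsrc := measurable_source (n := n) i
      have hS : Measurable fun ω : Outcome n => source i ω k := by fun_prop
      have hY : Measurable fun ω : Outcome n => output (uncodedEncoder v ρ P α β n) ω k := by
        fun_prop
      have hS₂ : MemLp (fun ω : Outcome n => source i ω k) 2 (linkLaw v ρ N n) := by
        rw [← hmp.map_eq, memLp_map_measure_iff hS.aestronglyMeasurable hmp.aemeasurable]
        simpa [Function.comp_def, source_outcomeOfWhite] using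
          memLp_whiteLaw_linear (N := N) (p i) (q i) 0 k
      have hY₂ : MemLp (fun ω : Outcome n => output (uncodedEncoder v ρ P α β n) ω k) 2
          (linkLaw v ρ N n) := by
        rw [← hmp.map_eq, memLp_map_measure_iff hY.aestronglyMeasurable hmp.aemeasurable]
        simp only [Function.comp_def, output, hinput]
        simpa [outcomeOfWhite] using memLp_whiteLaw_linear (N := N) (Real.sqrt P) 0 1 k
      -- the coefficient of the linear minimum mean squared-error estimate
      set c := p i * Real.sqrt P / (P + N) with hc
      refine (lintegral_sq_sub_condMean_le hY hS₂ hY₂ c).trans (ENNReal.ofReal_le_ofReal ?_)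
      rw [← hmp.map_eq, integral_map hmp.aemeasurable
        (Measurable.aestronglyMeasurable (by fun_prop))]
      simp only [output, hinput, source_outcomeOfWhite]
      have e (ω : (Fin n → ℝ × ℝ) × (Fin n → ℝ)) :
          p i * (ω.1 k).1 + q i * (ω.1 k).2 -
            c * (Real.sqrt P * (ω.1 k).1 + (outcomeOfWhite p q ω).2 k) =
          (p i - c * Real.sqrt P) * (ω.1 k).1 + q i * (ω.1 k).2 + (-c) * ω.2 k := by
        simp only [outcomeOfWhite]; ring
      simp_rw [e]
      rw [integral_whiteLaw_linear_sq hN]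
      have hs : Real.sqrt P ^ 2 = P := Real.sq_sqrt hP.le
      have hPN : P + N ≠ 0 := by positivity
      have h1 : c * Real.sqrt P = p i * P / (P + N) := by
        rw [hc]; field_simp; rw [hs]
      have h2 : c ^ 2 = p i ^ 2 * P / (P + N) ^ 2 := by
        rw [hc, div_pow, mul_pow, hs]
      rw [neg_sq, h1, h2]
      apply le_of_eq
      field_simp
      ring
    refine (Finset.sum_le_sum fun k _ => hk k).trans ?_
    simp [mul_comm]
  have hnn (i : Fin 2) : 0 ≤ p i ^ 2 * (N / (P + N)) + q i ^ 2 := by positivity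
  refine ⟨henc, fun i n => ?_, hpow, hnn 0, hnn 1, ?_, ?_⟩
  · exact measurable_pi_lambda _ fun k =>
      (StronglyMeasurable.integral_condDistrib (f := fun x : ℝ × ℝ => x.2)
        measurable_snd.stronglyMeasurable).measurable.comp (measurable_pi_apply k)
  · exact limsup_le_of_le (by isBoundedDefault) (Eventually.of_forall fun n => hdist 0 n)
  · exact limsup_le_of_le (by isBoundedDefault) (Eventually.of_forall fun n => hdist 1 n)

/-! ### Coordinates adapted to the uncoded scheme, and the threshold -/

theorem mixing_sq_pos {ρ α β : ℝ} (hρ₀ : 0 ≤ ρ) (hα : 0 ≤ α) (hβ : 0 ≤ β) (h : α ≠ 0 ∨ β ≠ 0) :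
    0 < α ^ 2 + 2 * α * β * ρ + β ^ 2 := by
  have : 0 ≤ 2 * α * β * ρ := by positivity
  rcases h with h | h
  · have : 0 < α ^ 2 := by positivity
    nlinarith [sq_nonneg β]
  · have : 0 < β ^ 2 := by positivity
    nlinarith [sq_nonneg α]

/-- The coefficients of `S₁, S₂` on the normalisation `T` of `α S₁ + β S₂`, for source variance
`σ ^ 2`. -/
noncomputable def signalCoeff (σ ρ α β : ℝ) : Fin 2 → ℝ :=
  ![σ * (α + β * ρ) / Real.sqrt (α ^ 2 + 2 * α * β * ρ + β ^ 2),
    σ * (α * ρ + β) / Real.sqrt (α ^ 2 + 2 * α * β * ρ + β ^ 2)]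

/-- The coefficients of `S₁, S₂` on the standard Gaussian `U` uncorrelated with `α S₁ + β S₂`. Its
sign is chosen so that `S₁` has a nonnegative coefficient. -/
noncomputable def residualCoeff (σ ρ α β : ℝ) : Fin 2 → ℝ :=
  ![σ * β * Real.sqrt (1 - ρ ^ 2) / Real.sqrt (α ^ 2 + 2 * α * β * ρ + β ^ 2),
    -(σ * α * Real.sqrt (1 - ρ ^ 2) / Real.sqrt (α ^ 2 + 2 * α * β * ρ + β ^ 2))]

section coeff

variable {σ ρ P N α β : ℝ}

theorem one_sub_sq_nonneg (hρ₀ : 0 ≤ ρ) (hρ₁ : ρ < 1) : 0 ≤ 1 - ρ ^ 2 := by nlinarith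

theorem signalCoeff_sq (hQ : 0 < α ^ 2 + 2 * α * β * ρ + β ^ 2) :
    signalCoeff σ ρ α β 0 ^ 2 = σ ^ 2 * (α + β * ρ) ^ 2 / (α ^ 2 + 2 * α * β * ρ + β ^ 2) ∧
    signalCoeff σ ρ α β 1 ^ 2 = σ ^ 2 * (α * ρ + β) ^ 2 / (α ^ 2 + 2 * α * β * ρ + β ^ 2) := by
  simp [signalCoeff, div_pow, mul_pow, Real.sq_sqrt hQ.le]

theorem residualCoeff_sq (hρ : 0 ≤ 1 - ρ ^ 2) (hQ : 0 < α ^ 2 + 2 * α * β * ρ + β ^ 2) :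
    residualCoeff σ ρ α β 0 ^ 2 =
      σ ^ 2 * β ^ 2 * (1 - ρ ^ 2) / (α ^ 2 + 2 * α * β * ρ + β ^ 2) ∧
    residualCoeff σ ρ α β 1 ^ 2 =
      σ ^ 2 * α ^ 2 * (1 - ρ ^ 2) / (α ^ 2 + 2 * α * β * ρ + β ^ 2) := by
  simp [residualCoeff, div_pow, mul_pow, Real.sq_sqrt hQ.le, Real.sq_sqrt hρ]

theorem coeff_sq_add_sq (hρ : 0 ≤ 1 - ρ ^ 2) (hQ : 0 < α ^ 2 + 2 * α * β * ρ + β ^ 2)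
    (i : Fin 2) : signalCoeff σ ρ α β i ^ 2 + residualCoeff σ ρ α β i ^ 2 = σ ^ 2 := by
  obtain ⟨h0, h1⟩ := signalCoeff_sq (σ := σ) hQ
  obtain ⟨h2, h3⟩ := residualCoeff_sq (σ := σ) hρ hQ
  fin_cases i
  · simp only [Fin.zero_eta, Fin.isValue]
    rw [h0, h2, ← add_div, div_eq_iff hQ.ne']; ring
  · simp only [Fin.mk_one, Fin.isValue]
    rw [h1, h3, ← add_div, div_eq_iff hQ.ne']; ring

theorem coeff_mul_add_mul (hρ : 0 ≤ 1 - ρ ^ 2) (hQ : 0 < α ^ 2 + 2 * α * β * ρ + β ^ 2) :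
    signalCoeff σ ρ α β 0 * signalCoeff σ ρ α β 1 +
      residualCoeff σ ρ α β 0 * residualCoeff σ ρ α β 1 = σ ^ 2 * ρ := by
  have hs := Real.sq_sqrt hQ.le
  have hr := Real.sq_sqrt hρ
  have hs₀ := Real.sqrt_pos.2 hQ
  simp only [signalCoeff, residualCoeff, Matrix.cons_val_zero, Matrix.cons_val_one]
  generalize Real.sqrt (α ^ 2 + 2 * α * β * ρ + β ^ 2) = s at hs hs₀ ⊢
  field_simp
  rw [hr, hs]
  ring

theorem uncodedDistortion₁_eq (hρ : 0 ≤ 1 - ρ ^ 2) (hP : 0 < P) (hN : 0 < N)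
    (hQ : 0 < α ^ 2 + 2 * α * β * ρ + β ^ 2) :
    uncodedDistortion₁ (σ ^ 2) ρ P N α β =
      signalCoeff σ ρ α β 0 ^ 2 * (N / (P + N)) + residualCoeff σ ρ α β 0 ^ 2 := by
  rw [(signalCoeff_sq hQ).1, (residualCoeff_sq hρ hQ).1, uncodedDistortion₁]
  have hPN : P + N ≠ 0 := by positivity
  have hQ' := hQ.ne'
  field_simp
  ring

/-- Exchanging `α` and `β` in `uncodedDistortion₁` gives the distortion on `S₂`, by the symmetry of
the source. -/
theorem uncodedDistortion₁_swap_eq (hρ : 0 ≤ 1 - ρ ^ 2) (hP : 0 < P) (hN : 0 < N)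
    (hQ : 0 < α ^ 2 + 2 * α * β * ρ + β ^ 2) :
    uncodedDistortion₁ (σ ^ 2) ρ P N β α =
      signalCoeff σ ρ α β 1 ^ 2 * (N / (P + N)) + residualCoeff σ ρ α β 1 ^ 2 := by
  have hQ' : 0 < β ^ 2 + 2 * β * α * ρ + α ^ 2 := by linarith
  rw [uncodedDistortion₁_eq hρ hP hN hQ', (signalCoeff_sq hQ').1, (residualCoeff_sq hρ hQ').1,
    (signalCoeff_sq hQ).2, (residualCoeff_sq hρ hQ).2]
  ring_nf

theorem uncodedScheme_achieves_uncodedDistortion (hσ : 0 < σ) (hρ : 0 ≤ 1 - ρ ^ 2) (hP : 0 < P)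
    (hN : 0 < N) (hQ : 0 < α ^ 2 + 2 * α * β * ρ + β ^ 2) :
    (uncodedScheme (σ ^ 2) ρ P N α β).Achieves (σ ^ 2) ρ P N
      (uncodedDistortion₁ (σ ^ 2) ρ P N α β) (uncodedDistortion₁ (σ ^ 2) ρ P N β α) := by
  rw [uncodedDistortion₁_eq hρ hP hN hQ, uncodedDistortion₁_swap_eq hρ hP hN hQ]
  refine uncodedScheme_achieves hP hN (coeff_sq_add_sq hρ hQ) (coeff_mul_add_mul hρ hQ) ?_ ?_
  · have hs := Real.sq_sqrt hQ.le
    have hs₀ := Real.sqrt_pos.2 hQ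
    have h1 : α * signalCoeff σ ρ α β 0 + β * signalCoeff σ ρ α β 1 =
        σ * Real.sqrt (α ^ 2 + 2 * α * β * ρ + β ^ 2) := by
      simp only [signalCoeff, Matrix.cons_val_zero, Matrix.cons_val_one]
      generalize Real.sqrt (α ^ 2 + 2 * α * β * ρ + β ^ 2) = s at hs hs₀ ⊢
      field_simp
      rw [hs]
      ring
    rw [h1, Real.sqrt_div hP.le, Real.sqrt_mul (sq_nonneg σ), Real.sqrt_sq hσ.le]
    exact div_mul_cancel₀ _ (mul_pos hσ hs₀).ne'
  · simp only [residualCoeff, Matrix.cons_val_zero, Matrix.cons_val_one]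
    ring

/-- Weights for the uncoded scheme force every scheme that is no worse on `S₁` to be no better on
`S₂`. -/
theorem BackwardWeights.uncodedDistortion_le {lam : Fin 2 → ℝ} {m : ℝ} (hρ : 0 ≤ 1 - ρ ^ 2)
    (hP : 0 < P) (hN : 0 < N) (hQ : 0 < α ^ 2 + 2 * α * β * ρ + β ^ 2)
    (h : BackwardWeights (signalCoeff σ ρ α β) (residualCoeff σ ρ α β) lam m ((P + N) / N))
    {c : Scheme} {D₁ D₂ : ℝ} (hc : c.Achieves (σ ^ 2) ρ P N D₁ D₂)
    (hD : D₁ ≤ uncodedDistortion₁ (σ ^ 2) ρ P N α β) :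
    uncodedDistortion₁ (σ ^ 2) ρ P N β α ≤ D₂ := by
  have h1 := h.le_of_achieves hP hN (coeff_sq_add_sq hρ hQ) (coeff_mul_add_mul hρ hQ) hc
  have h2 := mul_le_mul_of_nonneg_left hD (h.lam_pos 0).le
  rw [uncodedDistortion₁_eq hρ hP hN hQ] at h2
  rw [uncodedDistortion₁_swap_eq hρ hP hN hQ]
  refine le_of_mul_le_mul_left ?_ (h.lam_pos 1)
  have hA := h.fst_fst
  have hC := h.snd_snd
  simp only [Fin.sum_univ_two] at hA hC
  have hδ : (P + N) / N * (N / (P + N)) = 1 := by field_simp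
  linear_combination h1 + h2 + N / (P + N) * hA + hC + hδ

theorem backwardWeights_of_pos (hσ : 0 < σ) (hρ₀ : 0 ≤ ρ) (hρ₁ : ρ < 1) (hP : 0 < P) (hN : 0 < N)
    (hα : 0 < α) (hβ : 0 < β)
    (hsnr : (1 - ρ ^ 2) * P * α * β ≤ N * ρ * (α ^ 2 + 2 * α * β * ρ + β ^ 2)) :
    BackwardWeights (signalCoeff σ ρ α β) (residualCoeff σ ρ α β)
      ![(P + N) / N * α / (σ ^ 2 * (α + β * ρ)), (P + N) / N * β / (σ ^ 2 * (α * ρ + β))]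
      (1 - (P + N) / N * (1 - ρ ^ 2) * α * β / ((α + β * ρ) * (α * ρ + β))) ((P + N) / N) := by
  have hρ := one_sub_sq_nonneg hρ₀ hρ₁
  have hQ := mixing_sq_pos hρ₀ hα.le hβ.le (Or.inl hα.ne')
  have h₀ : 0 < α + β * ρ := by positivity
  have h₁ : 0 < α * ρ + β := by positivity
  obtain ⟨e0, e1⟩ := signalCoeff_sq (σ := σ) hQ
  obtain ⟨e2, e3⟩ := residualCoeff_sq (σ := σ) hρ hQ
  refine ⟨?_, ?_, ?_, ?_, ?_⟩
  · simp only [Fin.forall_fin_two, Matrix.cons_val_zero, Matrix.cons_val_one]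
    constructor <;> positivity
  · rw [sub_nonneg, div_le_one (by positivity), div_mul_eq_mul_div, div_mul_eq_mul_div,
      div_mul_eq_mul_div, div_le_iff₀ hN]
    linarith
  · simp only [Fin.sum_univ_two, Matrix.cons_val_zero, Matrix.cons_val_one]
    rw [e0, e1]
    field_simp
    ring
  · have hs := Real.sqrt_pos.2 hQ
    simp only [Fin.sum_univ_two, Matrix.cons_val_zero, Matrix.cons_val_one, signalCoeff,
      residualCoeff]
    field_simp
    ring
  · simp only [Fin.sum_univ_two, Matrix.cons_val_zero, Matrix.cons_val_one]
    rw [e2, e3]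
    field_simp
    ring

/-- For an uncorrelated source and `β = 0` the input does not depend on `S₂`, and the weight of `S₂` is
no longer determined by the vanishing of the mixed term; the choice `1 / σ ^ 2` leaves `m = 0`. -/
theorem backwardWeights_of_uncorrelated (hσ : 0 < σ) (hP : 0 < P) (hN : 0 < N) (hα : 0 < α) :
    BackwardWeights (signalCoeff σ 0 α 0) (residualCoeff σ 0 α 0)
      ![(P + N) / N / σ ^ 2, 1 / σ ^ 2] 0 ((P + N) / N) := by
  have hs : Real.sqrt (α ^ 2) = α := Real.sqrt_sq hα.le
  refine ⟨?_, le_rfl, ?_, ?_, ?_⟩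
  · simp only [Fin.forall_fin_two, Matrix.cons_val_zero, Matrix.cons_val_one]
    constructor <;> positivity
  all_goals simp [Fin.sum_univ_two, signalCoeff, residualCoeff, hs]
  all_goals field_simp

theorem min_le_uncodedDistortion₁ (hρ : 0 ≤ 1 - ρ ^ 2) (hP : 0 < P) (hN : 0 < N)
    (hQ : 0 < α ^ 2 + 2 * α * β * ρ + β ^ 2) :
    σ ^ 2 * (N / (P + N)) ≤ uncodedDistortion₁ (σ ^ 2) ρ P N α β := by
  rw [uncodedDistortion₁_eq hρ hP hN hQ, ← coeff_sq_add_sq hρ hQ 0]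
  have h1 : N / (P + N) ≤ 1 := (div_le_one (by positivity)).2 (by linarith)
  nlinarith [mul_le_mul_of_nonneg_left h1 (sq_nonneg (residualCoeff σ ρ α β 0))]

/-- The converse. For `β = 0` and `ρ > 0` the distortion on `S₁` is the least possible one, so the
scheme is also no worse on `S₁` than the uncoded schemes with small `b > 0`; their bounds on `S₂` are
passed to the limit `b → 0`. -/
theorem uncodedDistortion_le_of_achieves (hσ : 0 < σ) (hρ₀ : 0 ≤ ρ) (hρ₁ : ρ < 1) (hP : 0 < P)
    (hN : 0 < N) (hα : 0 < α) (hβ : 0 ≤ β)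
    (hsnr : (1 - ρ ^ 2) * P * α * β ≤ N * ρ * (α ^ 2 + 2 * α * β * ρ + β ^ 2))
    {c : Scheme} {D₂ : ℝ}
    (hc : c.Achieves (σ ^ 2) ρ P N (uncodedDistortion₁ (σ ^ 2) ρ P N α β) D₂) :
    uncodedDistortion₁ (σ ^ 2) ρ P N β α ≤ D₂ := by
  have hρ := one_sub_sq_nonneg hρ₀ hρ₁
  have hpos {b : ℝ} (hb : 0 < b)
      (hs : (1 - ρ ^ 2) * P * α * b ≤ N * ρ * (α ^ 2 + 2 * α * b * ρ + b ^ 2))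
      (hD : uncodedDistortion₁ (σ ^ 2) ρ P N α β ≤ uncodedDistortion₁ (σ ^ 2) ρ P N α b) :
      uncodedDistortion₁ (σ ^ 2) ρ P N b α ≤ D₂ :=
    (backwardWeights_of_pos hσ hρ₀ hρ₁ hP hN hα hb hs).uncodedDistortion_le hρ hP hN
      (mixing_sq_pos hρ₀ hα.le hb.le (Or.inl hα.ne')) hc hD
  rcases hβ.eq_or_lt with rfl | hβ
  · rcases hρ₀.eq_or_lt with rfl | hρ₀'
    · exact (backwardWeights_of_uncorrelated hσ hP hN hα).uncodedDistortion_le (by norm_num) hP hN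
        (by positivity) hc le_rfl
    · have hα₀ := hα.ne'
      have hmin : uncodedDistortion₁ (σ ^ 2) ρ P N α 0 = σ ^ 2 * (N / (P + N)) := by
        have : P + N ≠ 0 := by positivity
        simp only [uncodedDistortion₁]
        field_simp
        ring
      have hcont : ContinuousAt (fun b => uncodedDistortion₁ (σ ^ 2) ρ P N b α) 0 := by
        have : (P + N) ^ 2 * ((0 : ℝ) ^ 2 + 2 * 0 * α * ρ + α ^ 2) ≠ 0 := by
          have : 0 < P + N := by positivity
          simp; constructor <;> positivity
        unfold uncodedDistortion₁
        fun_prop (disch := assumption)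
      have hev : ∀ᶠ b in nhdsWithin (0 : ℝ) (Set.Ioi 0),
          (1 - ρ ^ 2) * P * α * b < N * ρ * (α ^ 2 + 2 * α * b * ρ + b ^ 2) := by
        refine Filter.Eventually.filter_mono nhdsWithin_le_nhds ?_
        refine ContinuousAt.eventually_lt (by fun_prop) (by fun_prop) ?_
        simp
        positivity
      refine le_of_tendsto (hcont.tendsto.mono_left nhdsWithin_le_nhds : Tendsto _
        (nhdsWithin (0 : ℝ) (Set.Ioi 0)) _) ?_
      filter_upwards [hev, self_mem_nhdsWithin] with b hb hb₀
      refine hpos hb₀ hb.le ?_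
      rw [hmin]
      exact min_le_uncodedDistortion₁ hρ hP hN
        (mixing_sq_pos hρ₀ hα.le (le_of_lt hb₀) (Or.inl hα.ne'))
  · exact hpos hβ hsnr le_rfl

/-- The threshold on the signal-to-noise ratio gives the sign condition on the weight `m`. -/
theorem snr_bound_of_le_snrThreshold (hσ : 0 < σ) (hρ₀ : 0 ≤ ρ) (hρ₁ : ρ < 1) (hP : 0 < P)
    (hN : 0 < N) (hα : 0 < α) (hβ : 0 ≤ β)
    (h : ((P / N : ℝ) : EReal) ≤
      snrThreshold (uncodedDistortion₁ (σ ^ 2) ρ P N α β) (σ ^ 2) ρ) :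
    (1 - ρ ^ 2) * P * α * β ≤ N * ρ * (α ^ 2 + 2 * α * β * ρ + β ^ 2) := by
  have hρ : 0 < 1 - ρ ^ 2 := by nlinarith
  have hQ := mixing_sq_pos hρ₀ hα.le hβ (Or.inl hα.ne')
  set D := uncodedDistortion₁ (σ ^ 2) ρ P N α β with hDdef
  have hD₀ : 0 < D :=
    lt_of_lt_of_le (by positivity) (min_le_uncodedDistortion₁ (σ := σ) hρ.le hP hN hQ)
  have hDeq : D * ((P + N) * (α ^ 2 + 2 * α * β * ρ + β ^ 2)) =
      σ ^ 2 * (N * (α ^ 2 + 2 * α * β * ρ + β ^ 2) + P * β ^ 2 * (1 - ρ ^ 2)) := by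
    have : P + N ≠ 0 := by positivity
    have hQ' := hQ.ne'
    rw [hDdef, uncodedDistortion₁]
    field_simp
    ring
  have hgap : (σ ^ 2 * (1 - ρ ^ 2) - D) * ((P + N) * (α ^ 2 + 2 * α * β * ρ + β ^ 2)) =
      σ ^ 2 * ((1 - ρ ^ 2) * P * α * (α + 2 * β * ρ) -
        N * ρ ^ 2 * (α ^ 2 + 2 * α * β * ρ + β ^ 2)) := by
    linear_combination -hDeq
  set Q := α ^ 2 + 2 * α * β * ρ + β ^ 2 with hQdef
  have hσ₂ : 0 < σ ^ 2 := by positivity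
  by_cases hlt : D < σ ^ 2 * (1 - ρ ^ 2)
  · rw [snrThreshold, if_pos ⟨hD₀, hlt⟩, EReal.coe_le_coe_iff,
      div_le_div_iff₀ hN (mul_pos hD₀ (sub_pos.2 hlt))] at h
    -- the threshold inequality, cleared of denominators, is a product whose second factor is positive
    have hfac : (σ ^ 2) ^ 2 * (P + N) * ((N * ρ * Q - (1 - ρ ^ 2) * P * α * β) *
        (N * ρ * Q + (1 - ρ ^ 2) * P * β * (α + 2 * β * ρ))) =
        (((σ ^ 2) ^ 2 * (1 - ρ ^ 2) - 2 * D * σ ^ 2 * (1 - ρ ^ 2) + D ^ 2) * N -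
          P * (D * (σ ^ 2 * (1 - ρ ^ 2) - D))) * ((P + N) * Q) ^ 2 := by
      rw [hQdef] at hDeq ⊢
      set K := (P + N) * (α ^ 2 + 2 * α * β * ρ + β ^ 2) with hK
      linear_combination ((2 * N + P) * σ ^ 2 * (1 - ρ ^ 2) * K - (P + N) * (D * K + σ ^ 2 *
        (N * (α ^ 2 + 2 * α * β * ρ + β ^ 2) + P * β ^ 2 * (1 - ρ ^ 2)))) * hDeq
    have h1 : 0 ≤ (N * ρ * Q - (1 - ρ ^ 2) * P * α * β) *
        (N * ρ * Q + (1 - ρ ^ 2) * P * β * (α + 2 * β * ρ)) := by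
      refine (mul_nonneg_iff_of_pos_left (by positivity : 0 < (σ ^ 2) ^ 2 * (P + N))).1 ?_
      rw [hfac]
      exact mul_nonneg (by linarith) (sq_nonneg _)
    rcases hβ.eq_or_lt with rfl | hβ'
    · simp only [mul_zero]
      positivity
    · exact sub_nonneg.1 (nonneg_of_mul_nonneg_left h1 (by positivity))
  · have hle : (1 - ρ ^ 2) * P * α * (α + 2 * β * ρ) ≤ N * ρ ^ 2 * Q := by
      by_contra hcon
      have h1 : 0 < (σ ^ 2 * (1 - ρ ^ 2) - D) * ((P + N) * Q) := by
        rw [hgap]; exact mul_pos hσ₂ (by linarith)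
      have h2 := pos_of_mul_pos_left h1 (by positivity)
      linarith
    rcases hρ₀.eq_or_lt with h0 | hρ₀'
    · exfalso
      rw [← h0] at hle
      have : 0 < P * α * α := by positivity
      nlinarith
    · refine le_of_mul_le_mul_left ?_ hρ₀'
      have h3 : 0 ≤ (1 - ρ ^ 2) * P * α * (α + β * ρ) := by positivity
      nlinarith

theorem exists_uncodedDistortion₁_eq {D : ℝ} (hσ : 0 < σ) (hρ₀ : 0 ≤ ρ) (hρ₁ : ρ < 1)
    (hP : 0 < P) (hN : 0 < N) (hmin : σ ^ 2 * (N / (N + P)) ≤ D)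
    (hD : D < σ ^ 2 * ((N + P * (1 - ρ ^ 2)) / (N + P))) :
    ∃ α β : ℝ, 0 ≤ α ∧ 0 ≤ β ∧ (α ≠ 0 ∨ β ≠ 0) ∧ uncodedDistortion₁ (σ ^ 2) ρ P N α β = D := by
  have hρ : 0 < 1 - ρ ^ 2 := by nlinarith
  have hσ₂ : 0 < σ ^ 2 := by positivity
  -- `s` is the squared correlation of `S₁` with the channel input
  set s := (σ ^ 2 - D) * (N + P) / (σ ^ 2 * P) with hs
  have hsD : s * (σ ^ 2 * P) = (σ ^ 2 - D) * (N + P) := by rw [hs]; field_simp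
  rw [← mul_div_assoc, div_le_iff₀ (by positivity)] at hmin
  rw [← mul_div_assoc, lt_div_iff₀ (by positivity)] at hD
  have hσP : 0 < σ ^ 2 * P := by positivity
  have hs₁ : s ≤ 1 := le_of_mul_le_mul_right (by linarith) hσP
  have hs₂ : ρ ^ 2 < s := lt_of_mul_lt_mul_right (by linarith) hσP.le
  have hs₀ : 0 ≤ s := (sq_nonneg ρ).trans hs₂.le
  have ha := Real.sq_sqrt hs₀
  have hb := Real.sq_sqrt (sub_nonneg.2 hs₁)
  have hr := Real.sq_sqrt hρ.le
  set a := Real.sqrt s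
  set b := Real.sqrt (1 - s)
  set r := Real.sqrt (1 - ρ ^ 2)
  have ha₀ : 0 ≤ a := Real.sqrt_nonneg _
  have hb₀ : 0 ≤ b := Real.sqrt_nonneg _
  have hr₀ : 0 ≤ r := Real.sqrt_nonneg _
  have hα : 0 < a * r - ρ * b := by
    refine sub_pos.2 (lt_of_pow_lt_pow_left₀ 2 (by positivity) ?_)
    rw [mul_pow, mul_pow, ha, hb, hr]
    nlinarith
  -- with these coefficients `α S₁ + β S₂` has correlation `a` with `S₁` and variance `r ^ 2 * σ ^ 2`
  refine ⟨a * r - ρ * b, b, hα.le, hb₀, Or.inl hα.ne', ?_⟩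
  have hQ : (a * r - ρ * b) ^ 2 + 2 * (a * r - ρ * b) * b * ρ + b ^ 2 = 1 - ρ ^ 2 := by
    linear_combination a ^ 2 * hr + (1 - ρ ^ 2) * ha + (1 - ρ ^ 2) * hb
  have hQ₀ : 0 < (a * r - ρ * b) ^ 2 + 2 * (a * r - ρ * b) * b * ρ + b ^ 2 := by rw [hQ]; exact hρ
  rw [uncodedDistortion₁_eq hρ.le hP hN hQ₀, (signalCoeff_sq hQ₀).1,
    (residualCoeff_sq hρ.le hQ₀).1, hQ, hb]
  have h1 : (a * r - ρ * b + b * ρ) ^ 2 = s * (1 - ρ ^ 2) := by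
    linear_combination r ^ 2 * ha + s * hr
  rw [h1]
  have : P + N ≠ 0 := by positivity
  field_simp
  linear_combination -hsD

end coeff

end GaussianLink

theorem proposition3 (σ ρ P N₁ D₁ : ℝ) (hσ : 0 < σ) (hρ₀ : 0 ≤ ρ) (hρ₁ : ρ < 1)
    (hP : 0 < P) (hN : 0 < N₁)
    (hmin : σ ^ 2 * (N₁ / (N₁ + P)) ≤ D₁)
    (hD : D₁ < σ ^ 2 * ((N₁ + P * (1 - ρ ^ 2)) / (N₁ + P)))
    (hsnr : ((P / N₁ : ℝ) : EReal) ≤ GaussianLink.snrThreshold D₁ (σ ^ 2) ρ) :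
    (∃ α β : ℝ, 0 ≤ α ∧ 0 ≤ β ∧ (α ≠ 0 ∨ β ≠ 0) ∧
      GaussianLink.uncodedDistortion₁ (σ ^ 2) ρ P N₁ α β = D₁) ∧
    ∀ α β : ℝ, 0 ≤ α → 0 ≤ β → (α ≠ 0 ∨ β ≠ 0) →
      GaussianLink.uncodedDistortion₁ (σ ^ 2) ρ P N₁ α β = D₁ →
      GaussianLink.leastDistortion₂ (σ ^ 2) ρ P N₁ D₁ =
        σ ^ 2 * ((P ^ 2 * α ^ 2 * (1 - ρ ^ 2) +
            P * N₁ * (α ^ 2 * (2 - ρ ^ 2) + 2 * α * β * ρ + β ^ 2) +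
            N₁ ^ 2 * (α ^ 2 + 2 * α * β * ρ + β ^ 2)) /
          ((P + N₁) ^ 2 * (α ^ 2 + 2 * α * β * ρ + β ^ 2))) ∧
      (GaussianLink.uncodedScheme (σ ^ 2) ρ P N₁ α β).Achieves (σ ^ 2) ρ P N₁ D₁
        (GaussianLink.leastDistortion₂ (σ ^ 2) ρ P N₁ D₁) := by
  have hρ := GaussianLink.one_sub_sq_nonneg hρ₀ hρ₁
  refine ⟨GaussianLink.exists_uncodedDistortion₁_eq hσ hρ₀ hρ₁ hP hN hmin hD, ?_⟩
  rintro α β hα₀ hβ h rfl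
  have hQ := GaussianLink.mixing_sq_pos hρ₀ hα₀ hβ h
  -- `α = 0` would put the distortion on `S₁` at the excluded upper end of its range
  have hα : 0 < α := by
    refine hα₀.lt_of_ne' fun h0 => hD.ne ?_
    have hβ₀ : β ≠ 0 := h.resolve_left (not_not.2 h0)
    have hPN : P + N₁ ≠ 0 := by positivity
    rw [h0, add_comm N₁ P, GaussianLink.uncodedDistortion₁]
    field_simp
    ring
  have hach := GaussianLink.uncodedScheme_achieves_uncodedDistortion hσ hρ hP hN hQ
  have hleast : GaussianLink.leastDistortion₂ (σ ^ 2) ρ P N₁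
      (GaussianLink.uncodedDistortion₁ (σ ^ 2) ρ P N₁ α β) =
      GaussianLink.uncodedDistortion₁ (σ ^ 2) ρ P N₁ β α := by
    refine IsLeast.csInf_eq ⟨⟨_, hach⟩, ?_⟩
    rintro D₂ ⟨c, hc⟩
    exact GaussianLink.uncodedDistortion_le_of_achieves hσ hρ₀ hρ₁ hP hN hα hβ
      (GaussianLink.snr_bound_of_le_snrThreshold hσ hρ₀ hρ₁ hP hN hα hβ hsnr) hc
  rw [hleast]
  refine ⟨?_, hach⟩
  rw [GaussianLink.uncodedDistortion₁]
  congr 2 <;> ring
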